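/- Let $\Lambda\subset\mathbb R^{48}$ be either of the lattices $P_{48p}$, $P_{48q}$. These are given by $$\Lambda=\Bigl\{\tfrac1{\sqrt{12}}\,x:\ x\in\mathbb Z^{48},\ \exists m\in\mathbb Z:\ x_i\equiv m\ (\mathrm{mod}\ 2)\ \text{for all } i,\ \ x\bmod 3\in C,\ \ \textstyle\sum_i x_i\equiv 2m\ (\mathrm{mod}\ 4)\Bigr\},$$ where $C$ is the ternary Pless symmetry code of length 48 (generator matrix $[I\mid S]$, $S$ the bordered Paley matrix of order 24) for $P_{48p}$, and the extended ternary quadratic residue code of length 48 for $P_{48q}$. Then $\Lambda$ has minimal norm (least squared length of a nonzero vector) $\mu=6$. For a subspace $U\subset\mathbb R^{48}$ put $V=U^\perp$ and let $\pi_U,\pi_V$ be the orthogonal projections. For a finite set $S\subset M:=\pi_U(\Lambda)$ put $\mathcal A(S)=\{\pi_V(w): w\in\Lambda,\ \pi_U(w)\in S\}\subset V$. Let $A_n$, $D_n$ be the root lattices, and write $R^*$ for the dual of a lattice $R$ in its real span. Let $(k,R,s,\beta,\delta)$ be one of $$\begin{array}{lllll} (1, & A_1, & 2, & 1/6, & 2^{-70}\,3^{-24}\,35^{23.5}),\\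 (2, & A_2, & 3, & 2/9, & 3^{-46.5}\,13^{23}),\\ (3, & A_3, & 4, & 1/3, & 2^{-44}\,3^{-24}\,17^{22.5}),\\ (4, & D_4, & 4, & 1/3, & 2^{-43}\,3^{-24}\,17^{22}). \end{array}$$ Then there is a subspace $U$ of dimension $k$ such that $\Lambda\cap U$ and $\Lambda\cap V$ span $U$ and $V$, respectively, and $M=\pi_U(\Lambda)$ is isometric to $\frac1{\sqrt3}R^*$. For every such $U$ there is a set $S\subset M$ of $s$ points with all mutual squared distances at most $\beta$. For every such $U$ and $S$, the balls of radius $\rho=\frac12\sqrt{6-\beta}$ around the points of $\mathcal A(S)$ form a sphere packing in the space $V$ of dimension $l=48-k$ (thus $l=47,46,45,44$, respectively), and this packing has center density $\delta$. (The center density is the density, i.e. the limit as $R\to\infty$ of the proportion of the ball of radius $R$ about $0$ that is covered by the balls, divided by the volume of the unit ball of $\mathbb R^l$.) -/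

import Mathlib

open scoped Pointwise

/-! ### Integral lattices in Euclidean spaces -/

/-- `μ` is the minimal norm (least squared length of a nonzero vector) of `Λ`. -/
def HasMinNorm {E : Type*} [NormedAddCommGroup E]
    (Λ : Submodule ℤ E) (μ : ℝ) : Prop :=
  IsLeast {r : ℝ | ∃ x ∈ Λ, x ≠ 0 ∧ ‖x‖ ^ 2 = r} μ

/-- The dual lattice `K*`: the vectors in the real span of `K` that have integral inner product
with every vector of `K`. -/
noncomputable def dualLattice {E : Type*} [NormedAddCommGroup E] [InnerProductSpace ℝ E]
    (K : Submodule ℤ E) : Submodule ℤ E :=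
  LinearMap.BilinForm.dualSubmodule (innerₗ E) K ⊓
    (Submodule.span ℝ (K : Set E)).restrictScalars ℤ

/-- Isometry of lattices that may lie in different Euclidean spaces. -/
def LatticeIsometric {E F : Type*} [NormedAddCommGroup E] [NormedAddCommGroup F]
    (M : Submodule ℤ E) (N : Submodule ℤ F) : Prop :=
  ∃ f : M ≃ₗ[ℤ] N, ∀ x : M, ‖(f x : F)‖ = ‖(x : E)‖

/-- The root lattice `A_n`: integral vectors in `ℝ^(n+1)` with coordinate sum zero. -/
def rootA (n : ℕ) : Submodule ℤ (EuclideanSpace ℝ (Fin (n + 1))) where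
  carrier := {x | (∀ i, ∃ m : ℤ, x i = m) ∧ ∑ i, x i = 0}
  zero_mem' := ⟨fun _ => ⟨0, by simp⟩, by simp⟩
  add_mem' := by
    rintro x y ⟨hx, hx'⟩ ⟨hy, hy'⟩
    refine ⟨fun i => ?_, ?_⟩
    · obtain ⟨a, ha⟩ := hx i
      obtain ⟨b, hb⟩ := hy i
      exact ⟨a + b, by simp [ha, hb]⟩
    · simp [Finset.sum_add_distrib, hx', hy']
  smul_mem' := by
    rintro c x ⟨hx, hx'⟩
    refine ⟨fun i => ?_, ?_⟩
    · obtain ⟨a, ha⟩ := hx i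
      exact ⟨c * a, by simp [ha]⟩
    · simp [← Finset.mul_sum, hx']

/-- The root lattice `D_n`: integral vectors in `ℝ^n` with even coordinate sum. -/
def rootD (n : ℕ) : Submodule ℤ (EuclideanSpace ℝ (Fin n)) where
  carrier := {x | (∀ i, ∃ m : ℤ, x i = m) ∧ ∃ m : ℤ, ∑ i, x i = 2 * m}
  zero_mem' := ⟨fun _ => ⟨0, by simp⟩, 0, by simp⟩
  add_mem' := by
    rintro x y ⟨hx, p, hp⟩ ⟨hy, q, hq⟩
    refine ⟨fun i => ?_, p + q, ?_⟩
    · obtain ⟨a, ha⟩ := hx i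
      obtain ⟨b, hb⟩ := hy i
      exact ⟨a + b, by simp [ha, hb]⟩
    · simp [Finset.sum_add_distrib, hp, hq, mul_add]
  smul_mem' := by
    rintro c x ⟨hx, p, hp⟩
    refine ⟨fun i => ?_, c * p, ?_⟩
    · obtain ⟨a, ha⟩ := hx i
      exact ⟨c * a, by simp [ha]⟩
    · simp [← Finset.mul_sum, hp, mul_left_comm]

/-! ### The two ternary codes of length 48 -/

/-- The ternary quadratic residue code of length 47: the cyclic code spanned by the cyclic shifts
of the indicator vector of the nonzero squares modulo 47.
(Minus the polynomial `∑ x^r`, over the quadratic residues `r`, is its generating idempotent.) -/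
def qrCode47 : Submodule (ZMod 3) (Fin 47 → ZMod 3) :=
  Submodule.span (ZMod 3) (Set.range fun (j : ZMod 47) (i : Fin 47) =>
    if ((i : ℕ) : ZMod 47) ≠ j ∧ IsSquare (((i : ℕ) : ZMod 47) - j) then (1 : ZMod 3) else 0)

/-- The extended quadratic residue code of length 48: an overall parity check is added, in
coordinate `0`, to the words of the quadratic residue code. -/
def extendedQRCode48 : Submodule (ZMod 3) (Fin 48 → ZMod 3) where
  carrier := {c | ∑ i, c i = 0 ∧ (fun i : Fin 47 => c i.succ) ∈ qrCode47}
  zero_mem' := ⟨by simp, qrCode47.zero_mem⟩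
  add_mem' := by
    rintro x y ⟨hx, hx'⟩ ⟨hy, hy'⟩
    exact ⟨by simp [Finset.sum_add_distrib, hx, hy], qrCode47.add_mem hx' hy'⟩
  smul_mem' := by
    rintro c x ⟨hx, hx'⟩
    exact ⟨by simp [← Finset.mul_sum, hx], qrCode47.smul_mem c hx'⟩

instance fact_prime_twentyThree : Fact (Nat.Prime 23) := ⟨by norm_num⟩

/-- The bordered Paley matrix of order 24. Index `0` is the point `∞`, index `i + 1` is the
element `i` of the field with 23 elements; the entries are `0` at `(∞, ∞)`, `1` in the rest of
row `∞`, `χ(-1) = -1` in the rest of column `∞`, and `χ(j - i)` at `(i, j)`, where `χ` is the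
quadratic character. -/
def plessMatrix : Matrix (Fin 24) (Fin 24) (ZMod 3) :=
  Matrix.of fun i j =>
    Fin.cases (motive := fun _ => ZMod 3)
      (Fin.cases (motive := fun _ => ZMod 3) 0 (fun _ : Fin 23 => 1) j)
      (fun i' : Fin 23 => Fin.cases (motive := fun _ => ZMod 3) (-1)
        (fun j' : Fin 23 =>
          ((quadraticChar (ZMod 23) (((j' : ℕ) : ZMod 23) - ((i' : ℕ) : ZMod 23)) : ℤ) : ZMod 3))
        j) i

/-- The Pless symmetry (double circulant) code of length 48, with generator matrix `[I | S]`,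
`S` being the bordered Paley matrix of order 24. -/
def plessCode48 : Submodule (ZMod 3) (Fin 48 → ZMod 3) :=
  Submodule.span (ZMod 3) (Set.range fun i : Fin 24 =>
    (Fin.append (Pi.single i (1 : ZMod 3)) (plessMatrix i) : Fin (24 + 24) → ZMod 3))

/-! ### The lattices P48p and P48q -/

/-- The lattice of all `x / √12` with `x` an integral vector such that, for some integer `m`, all
coordinates are congruent to `m` modulo `2`, `x` modulo `3` is in the code `C`, and the coordinate
sum is congruent to `2m` modulo `4`.

For a self-dual code `C` of length 48 that contains the all-ones word this is the even unimodular
lattice `Λ₀ ∪ (Λ₀ + (1/√12)(-5, 1, …, 1))`, where `Λ₀` is the even sublattice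
`{z / √3 : z mod 3 ∈ C, ∑ zᵢ even}` of the unimodular lattice obtained from `C` by
Construction A. (Both codes used here contain the all-ones word.) -/
def ternaryCodeLattice (C : Submodule (ZMod 3) (Fin 48 → ZMod 3)) :
    Submodule ℤ (EuclideanSpace ℝ (Fin 48)) where
  carrier := {v | ∃ (x : Fin 48 → ℤ) (m : ℤ),
    (∀ i, v i = (x i : ℝ) / √12) ∧ (∀ i, x i ≡ m [ZMOD 2]) ∧
      (fun i => ((x i : ℤ) : ZMod 3)) ∈ C ∧ ∑ i, x i ≡ 2 * m [ZMOD 4]}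
  zero_mem' := ⟨0, 0, by simp, fun _ => rfl, by
    have : (fun i : Fin 48 => (((0 : Fin 48 → ℤ) i : ℤ) : ZMod 3)) = 0 := by ext; simp
    rw [this]; exact C.zero_mem, by simp⟩
  add_mem' := by
    rintro v w ⟨x, m, hv, hx2, hx3, hx4⟩ ⟨y, n, hw, hy2, hy3, hy4⟩
    refine ⟨x + y, m + n, fun i => ?_, fun i => (hx2 i).add (hy2 i), ?_, ?_⟩
    · simp [hv i, hw i, add_div]
    · have := C.add_mem hx3 hy3
      convert this using 1
      ext i; simp
    · have := hx4.add hy4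
      simpa [Finset.sum_add_distrib, mul_add] using this
  smul_mem' := by
    rintro c v ⟨x, m, hv, hx2, hx3, hx4⟩
    refine ⟨fun i => c * x i, c * m, fun i => ?_, fun i => (hx2 i).mul_left c, ?_, ?_⟩
    · simp [hv i, mul_div_assoc]
    · have := C.smul_mem (c : ZMod 3) hx3
      convert this using 1
      ext i; simp
    · have := hx4.mul_left c
      simpa [Finset.mul_sum, mul_left_comm] using this

/-- The lattice `P48p`, from the Pless symmetry code. -/
def P48p : Submodule ℤ (EuclideanSpace ℝ (Fin 48)) := ternaryCodeLattice plessCode48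

/-- The lattice `P48q`, from the extended quadratic residue code. -/
def P48q : Submodule ℤ (EuclideanSpace ℝ (Fin 48)) := ternaryCodeLattice extendedQRCode48

/-! ### Sphere packings -/

section Packing

variable {E : Type*} [NormedAddCommGroup E] [InnerProductSpace ℝ E]

/-- The balls of radius `ρ` around the points of `A` form a sphere packing. -/
def IsSpherePacking (A : Set E) (ρ : ℝ) : Prop :=
  0 < ρ ∧ A.PairwiseDisjoint fun a => Metric.ball a ρ

variable [FiniteDimensional ℝ E] [MeasurableSpace E] [BorelSpace E]

/-- The balls of radius `ρ` around the points of `A` cover the proportion `Δ` of the space. -/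
def HasDensity (A : Set E) (ρ Δ : ℝ) : Prop :=
  Filter.Tendsto (fun R : ℝ =>
      MeasureTheory.volume.real (Metric.ball (0 : E) R ∩ ⋃ a ∈ A, Metric.ball a ρ) /
        MeasureTheory.volume.real (Metric.ball (0 : E) R))
    Filter.atTop (nhds Δ)

/-- The center density is the density divided by the volume of the unit ball. -/
def HasCenterDensity (A : Set E) (ρ δ : ℝ) : Prop :=
  HasDensity A ρ (δ * MeasureTheory.volume.real (Metric.ball (0 : E) 1))

end Packing

/-! ### The antipode construction -/

section Antipode

variable {E : Type*} [NormedAddCommGroup E] [InnerProductSpace ℝ E] [FiniteDimensional ℝ E]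

/-- The projection `M = π_U(Λ)`. -/
noncomputable def projLattice (Λ : Submodule ℤ E) (U : Submodule ℝ E) : Submodule ℤ U :=
  Λ.map (U.orthogonalProjectionOnto.toLinearMap.restrictScalars ℤ)

/-- With `V` the orthogonal complement of `U`, the lattices `K = Λ ∩ U` and `L = Λ ∩ V` have full
rank in `U` and `V`. -/
def SplitsAlong (Λ : Submodule ℤ E) (U : Submodule ℝ E) : Prop :=
  Submodule.span ℝ ((Λ : Set E) ∩ U) = U ∧ Submodule.span ℝ ((Λ : Set E) ∩ Uᗮ) = Uᗮ

/-- `S` consists of `s` points of `M = π_U(Λ)` with all mutual squared distances at most `β`. -/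
def IsCloseSubset (Λ : Submodule ℤ E) (U : Submodule ℝ E) (s : ℕ) (β : ℝ) (S : Finset U) : Prop :=
  (∀ u ∈ S, u ∈ projLattice Λ U) ∧ S.card = s ∧ ∀ u ∈ S, ∀ v ∈ S, dist u v ^ 2 ≤ β

/-- The antipodal set `𝒜(S) = {π_V(w) : w ∈ Λ, π_U(w) ∈ S}` in `V`, the orthogonal complement
of `U`. -/
noncomputable def antipode (Λ : Submodule ℤ E) (U : Submodule ℝ E) (S : Finset U) :
    Set (Uᗮ : Submodule ℝ E) :=
  {v | ∃ w ∈ Λ, U.orthogonalProjectionOnto w ∈ S ∧ Uᗮ.orthogonalProjectionOnto w = v}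

variable [MeasurableSpace E] [BorelSpace E]

/-- The antipode construction, applied to the lattice `Λ` of minimal norm `μ` and subspaces `U` of
dimension `k` and `V` (the orthogonal complement) of dimension `l` such that `π_U(Λ)` is isometric
to `M`, and to sets of `s` points of `π_U(Λ)` at mutual squared distance at most `β`:
such `U` exist; for each of them such sets `S` exist; and each of these yields an `l`-dimensional
sphere packing with centers `𝒜(S)`, radius `½√(μ - β)` and center density `δ`. -/
def AntipodeConstructionGives {F : Type*} [NormedAddCommGroup F]
    (Λ : Submodule ℤ E) (μ : ℝ) (k l : ℕ) (M : Submodule ℤ F) (s : ℕ) (β δ : ℝ) : Prop :=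
  HasMinNorm Λ μ ∧
  (∃ U : Submodule ℝ E, Module.finrank ℝ U = k ∧ Module.finrank ℝ (Uᗮ : Submodule ℝ E) = l ∧
    SplitsAlong Λ U ∧ LatticeIsometric (projLattice Λ U) M) ∧
  ∀ U : Submodule ℝ E, Module.finrank ℝ U = k → Module.finrank ℝ (Uᗮ : Submodule ℝ E) = l →
    SplitsAlong Λ U → LatticeIsometric (projLattice Λ U) M →
    (∃ S : Finset U, IsCloseSubset Λ U s β S) ∧
    ∀ S : Finset U, IsCloseSubset Λ U s β S →
      IsSpherePacking (antipode Λ U S) (1 / 2 * √(μ - β)) ∧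
      HasCenterDensity (antipode Λ U S) (1 / 2 * √(μ - β)) δ

end Antipode

/-! Packing. Let `w, w' ∈ Λ` have distinct projections to `V` and projections to `U` at squared
distance at most `β`. Since `‖w - w'‖² ≥ 6`, Pythagoras leaves at least `6 - β = (2ρ)²` for the
`V`-parts, so the balls are disjoint (`isSpherePacking_antipode`). The centers form one translate of
`L = Λ ∩ V` for each point of `S`; two of these cannot coincide, as this would give a nonzero vector
of `Λ ∩ U` of squared norm at most `β < 6`. Hence the center density is `s ρ^l / covol L`
(`hasCenterDensity_antipode`). Lifts of a basis of `M` together with a basis of `L` form a basis of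
`Λ`, so `covol Λ² = det M · covol L²` (`covolume_sq_eq_mul`). As `covol Λ = 1`, the center density
is `s ρ^l √(det M)`, whatever `U` is.

Minimal norm. Take `x / √12` in `Λ`. If `x = 2y`, then `6` divides `∑ y_i²`; if this sum is below 18
it is at most 12, and a minimum weight above 12 forces `3 ∣ y`, whence `y = 0`. If `x` is odd and `∑
x_i² < 72`, congruences modulo 8 and 3 force all `x_i = ±1`; such codewords have an even number of
entries `-1`, against the condition modulo 4 (`IsGoodCode.hasMinNorm`). Covolume 1 is an index count
(`IsGoodCode.covolume_sq`).

Existence of `U`. The code takes arbitrary values on four suitable coordinates. Restricted to `r ≤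
4` of these, `Λ` becomes the set of all `y / √12` with the `y_i` of equal parity, that is `D_r* /
√3`. For `R ⊆ D_r` the lattice `√3 R` lies in `Λ`, and projecting further to the span of `R` gives
`R* / √3` (`mem_smul_dualLattice_iff`).

Codes. Both codes consist, up to a permutation, of words `(a, aA)` with `A Aᵀ = -1` and `A D A = E`
for invertible diagonal `D`, `E`. The second relation exchanges the two halves, so the minimum
weight needs only the `a` of weight at most 6 (`IsSystematic.isGoodCode`). These, and the words
without zeros, are enumerated by computation, with one binary digit per word. -/

/-! ### Bit-sliced enumeration of ternary words -/

namespace TernaryLanes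

/-- The entry `(i, j)` of the ternary matrix of order 24 encoded by the base-4 digits of `A`. -/
def entry (A i j : ℕ) : ℕ :=
  Nat.mod (Nat.shiftRight A (Nat.mul 2 (Nat.add (Nat.mul 24 i) j))) 4

/-- Selection by `c = 0`, `c = 1`, `c ≥ 2`. -/
def pick (c x y z : ℕ) : ℕ := Nat.rec x (fun k _ => Nat.rec y (fun _ _ => z) k) c

/-- The number of ternary words of length `n` and weight `w`. -/
def len (n w : ℕ) : ℕ := Nat.mul (Nat.choose n w) (Nat.pow 2 w)

/-- The bits of `lane A j n w v` run over the ternary words `a` of length `n` and weight `w`; a bit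
is set when `a` times the first `n` entries of column `j` of `A` is `v`. -/
def lane (A j n : ℕ) : ℕ → ℕ → ℕ :=
  Nat.rec (fun w v => Nat.rec (pick v 1 0 0) (fun _ _ => 0) w)
    (fun n ih w v => Nat.rec (pick v 1 0 0) (fun w _ =>
      Nat.lor (ih (Nat.succ w) v) (Nat.lor
        (Nat.shiftLeft
          (pick (Nat.mod (Nat.add v (Nat.mul 2 (entry A n j))) 3) (ih w 0) (ih w 1) (ih w 2))
          (len n (Nat.succ w)))
        (Nat.shiftLeft (pick (Nat.mod (Nat.add v (entry A n j)) 3) (ih w 0) (ih w 1) (ih w 2))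
          (Nat.add (len n (Nat.succ w)) (len n w))))) w) n

/-- As `lane`, for the parity of the number of entries `-1` of the word. -/
def par (n : ℕ) : ℕ → ℕ → ℕ :=
  Nat.rec (fun w v => Nat.rec (pick v 1 0 0) (fun _ _ => 0) w)
    (fun n ih w v => Nat.rec (pick v 1 0 0) (fun w _ =>
      Nat.lor (ih (Nat.succ w) v) (Nat.lor
        (Nat.shiftLeft (ih w v) (len n (Nat.succ w)))
        (Nat.shiftLeft (pick v (ih w 1) (ih w 0) 0)
          (Nat.add (len n (Nat.succ w)) (len n w))))) w) n

/-- The words whose product with column `j`, increased by `c`, is nonzero. -/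
def nz (A j n w c : ℕ) : ℕ :=
  pick c (Nat.lor (lane A j n w 1) (lane A j n w 2)) (Nat.lor (lane A j n w 0) (lane A j n w 1))
    (Nat.lor (lane A j n w 0) (lane A j n w 2))

/-- The words whose product with column `j`, increased by `c`, is `-1`. -/
def minusOne (A j n w c : ℕ) : ℕ := pick c (lane A j n w 2) (lane A j n w 1) (lane A j n w 0)

/-- Increment of the bit-sliced binary counters `bs` at the bits set in `x`. -/
def inc (bs : List ℕ) : ℕ → List ℕ :=
  List.rec (fun _ => []) (fun b _ ih x => Nat.xor b x :: ih (Nat.land b x)) bs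

/-- Counters for the number of nonzero entries, among the first `k` columns, of the sum of row `m`
and a combination of `w` earlier rows. -/
def cnt (A m w k : ℕ) : List ℕ :=
  Nat.rec [0, 0, 0, 0, 0] (fun j ih => inc ih (nz A j m w (entry A m j))) k

/-- The bits at which the counters `bs` are at least `c`. -/
def ge (mask : ℕ) (bs : List ℕ) : ℕ → ℕ :=
  List.rec (fun c => Nat.rec mask (fun _ _ => 0) c)
    (fun b _ ih c => Nat.rec (ih (Nat.div c 2))
      (fun _ _ => Nat.lor (ih (Nat.div (Nat.succ c) 2)) (Nat.land b (ih (Nat.div c 2))))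
      (Nat.mod c 2)) bs

/-- The coefficient 1 of row `m` counts as well: the left half has weight `w + 1`, and `12 - w`
nonzero entries on the right bring the total to at least 13. -/
def lightCheck (A m w : ℕ) : Bool :=
  Nat.beq (ge (Nat.pred (Nat.pow 2 (len m w))) (cnt A m w 24) (Nat.sub 12 w))
    (Nat.pred (Nat.pow 2 (len m w)))

def all (n : ℕ) (p : ℕ → Bool) : Bool := Nat.rec true (fun k ih => Bool.rec false ih (p k)) n

def nzAll (A m w k : ℕ) : ℕ :=
  Nat.rec (Nat.pred (Nat.pow 2 (len m w))) (fun j ih => Nat.land ih (nz A j m w (entry A m j))) k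

/-- The coefficient of row `m` is 1 and contributes no entry `-1`, so the parity of the left half is
that of the earlier coefficients. -/
def oddAll (A m w k : ℕ) : ℕ :=
  Nat.rec (par m w 1) (fun j ih => Nat.xor ih (minusOne A j m w (entry A m j))) k

def parityCheck (A m w : ℕ) : Bool := Nat.beq (Nat.land (nzAll A m w 24) (oddAll A m w 24)) 0

/-! ### Correctness of the bit-sliced enumeration -/

theorem all_eq_true {n : ℕ} {p : ℕ → Bool} (h : all n p = true) {k : ℕ} (hk : k < n) :
    p k = true := by
  induction n with
  | zero => omega
  | succ n ih =>
    have h' : (Bool.rec false (all n p) (p n) : Bool) = true := h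
    cases hp : p n with
    | false => rw [hp] at h'; exact absurd h' (by simp)
    | true =>
      rw [hp] at h'
      rcases Nat.lt_succ_iff_lt_or_eq.mp hk with hk | rfl
      · exact ih h' hk
      · exact hp

theorem len_zero (n : ℕ) : len n 0 = 1 := by simp [len]

theorem len_succ (n w : ℕ) : len (n + 1) (w + 1) = len n (w + 1) + len n w + len n w := by
  simp only [len, Nat.mul_eq, Nat.pow_eq, Nat.choose_succ_succ, pow_succ]
  ring

theorem lane_zero (A j n v : ℕ) : lane A j n 0 v = pick v 1 0 0 := by cases n <;> rfl

theorem lane_succ (A j n w v : ℕ) : lane A j (n + 1) (w + 1) v =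
    lane A j n (w + 1) v |||
      (pick ((v + 2 * entry A n j) % 3) (lane A j n w 0) (lane A j n w 1) (lane A j n w 2)
          <<< len n (w + 1) |||
        pick ((v + entry A n j) % 3) (lane A j n w 0) (lane A j n w 1) (lane A j n w 2)
          <<< (len n (w + 1) + len n w)) := rfl

theorem par_zero (n v : ℕ) : par n 0 v = pick v 1 0 0 := by cases n <;> rfl

theorem par_succ (n w v : ℕ) : par (n + 1) (w + 1) v =
    par n (w + 1) v ||| (par n w v <<< len n (w + 1) |||
      pick v (par n w 1) (par n w 0) 0 <<< (len n (w + 1) + len n w)) := rfl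

theorem pick_of_lt (f : ℕ → ℕ) {c : ℕ} (hc : c < 3) : pick c (f 0) (f 1) (f 2) = f c := by
  interval_cases c <;> rfl

theorem testBit_pick_one {t v : ℕ} (ht : 0 < t) : (pick v 1 0 0).testBit t = false := by
  obtain ⟨t, rfl⟩ := Nat.exists_eq_add_of_lt ht
  rcases v with _ | _ | v <;> simp [pick, Nat.testBit_succ]

/-- No bit is set beyond the number of words, so the shifted blocks in the recursion do not overlap.
-/
theorem testBit_lane_of_le {A j n w v t : ℕ} (ht : len n w ≤ t) :
    (lane A j n w v).testBit t = false := by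
  induction n generalizing w v t with
  | zero =>
    cases w with
    | zero => rw [lane_zero]; exact testBit_pick_one (by rw [len_zero] at ht; omega)
    | succ w => exact Nat.zero_testBit t
  | succ n ih =>
    cases w with
    | zero => rw [lane_zero]; exact testBit_pick_one (by rw [len_zero] at ht; omega)
    | succ w =>
      rw [len_succ] at ht
      have hm (x : ℕ) : x % 3 < 3 := Nat.mod_lt _ (by norm_num)
      rw [lane_succ, pick_of_lt (lane A j n w) (hm _), pick_of_lt (lane A j n w) (hm _)]
      simp only [Nat.testBit_or, Nat.testBit_shiftLeft, ih (w := w + 1) (t := t) (by omega),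
        ih (w := w) (t := t - len n (w + 1)) (by omega),
        ih (w := w) (t := t - (len n (w + 1) + len n w)) (by omega), Bool.and_false, Bool.or_false]

theorem testBit_par_of_le {n w v t : ℕ} (hv : v < 2) (ht : len n w ≤ t) :
    (par n w v).testBit t = false := by
  induction n generalizing w v t with
  | zero =>
    cases w with
    | zero => rw [par_zero]; exact testBit_pick_one (by rw [len_zero] at ht; omega)
    | succ w => exact Nat.zero_testBit t
  | succ n ih =>
    cases w with
    | zero => rw [par_zero]; exact testBit_pick_one (by rw [len_zero] at ht; omega)
    | succ w =>
      rw [len_succ] at ht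
      have hp : pick v (par n w 1) (par n w 0) 0 = par n w (1 - v) := by
        interval_cases v <;> rfl
      rw [par_succ, hp]
      simp only [Nat.testBit_or, Nat.testBit_shiftLeft, ih (w := w + 1) (t := t) hv (by omega),
        ih (w := w) (t := t - len n (w + 1)) hv (by omega),
        ih (w := w) (v := 1 - v) (t := t - (len n (w + 1) + len n w)) (by omega) (by omega),
        Bool.and_false, Bool.or_false]

/-- The product of the first `n` entries of `a` and of column `j`. -/
def dot (A j n : ℕ) (a : ℕ → ZMod 3) : ZMod 3 := ∑ i ∈ Finset.range n, a i * (entry A i j : ZMod 3)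

/-- The number of nonzero entries among the first `n`. -/
def wt (n : ℕ) (a : ℕ → ZMod 3) : ℕ := ∑ i ∈ Finset.range n, if a i = 0 then 0 else 1

/-- The number of entries `-1` among the first `n`. -/
def neg (n : ℕ) (a : ℕ → ZMod 3) : ℕ := ∑ i ∈ Finset.range n, if a i = 2 then 1 else 0

theorem eq_zero_of_wt_eq_zero {n : ℕ} {a : ℕ → ZMod 3} (h : wt n a = 0) {i : ℕ} (hi : i < n) :
    a i = 0 := by
  have := Finset.sum_eq_zero_iff.mp h i (Finset.mem_range.mpr hi)
  by_contra hne
  simp [hne] at this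

/-- The position `t` depends on the word alone, not on the matrix, the column or the value.
Therefore bitwise operations on lanes of different columns combine facts about one and the same
word. The induction follows the three blocks of the recursion, with last entry 0, 1 and -1. -/
theorem exists_lane (n w : ℕ) (a : ℕ → ZMod 3) (ha : wt n a = w) :
    ∃ t < len n w,
      (∀ A j v : ℕ, v < 3 → (lane A j n w v).testBit t = decide (dot A j n a = v)) ∧
      ∀ v < 2, (par n w v).testBit t = decide (neg n a % 2 = v) := by
  have zero (n : ℕ) (ha : wt n a = 0) : ∃ t < len n 0,
      (∀ A j v : ℕ, v < 3 → (lane A j n 0 v).testBit t = decide (dot A j n a = v)) ∧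
      ∀ v < 2, (par n 0 v).testBit t = decide (neg n a % 2 = v) := by
    refine ⟨0, by simp [len_zero], fun A j v hv => ?_, fun v hv => ?_⟩
    · have : dot A j n a = 0 := Finset.sum_eq_zero fun i hi => by
        rw [eq_zero_of_wt_eq_zero ha (Finset.mem_range.mp hi), zero_mul]
      rw [lane_zero, this]
      interval_cases v <;> decide
    · have : neg n a = 0 := Finset.sum_eq_zero fun i hi => by
        rw [eq_zero_of_wt_eq_zero ha (Finset.mem_range.mp hi)]; decide
      rw [par_zero, this]
      interval_cases v <;> decide
  induction n generalizing w with
  | zero =>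
    subst ha
    exact zero 0 rfl
  | succ n ih =>
    cases w with
    | zero => exact zero _ ha
    | succ w =>
      have hm (x : ℕ) : x % 3 < 3 := Nat.mod_lt _ (by norm_num)
      have hl (A j v : ℕ) := lane_succ A j n w v
      have hp (v : ℕ) (hv : v < 2) : par (n + 1) (w + 1) v =
          par n (w + 1) v ||| (par n w v <<< len n (w + 1) |||
            par n w (1 - v) <<< (len n (w + 1) + len n w)) := by
        rw [par_succ]
        interval_cases v <;> rfl
      simp only [pick_of_lt (lane _ _ _ _) (hm _)] at hl
      have hwt : wt (n + 1) a = wt n a + if a n = 0 then 0 else 1 := Finset.sum_range_succ ..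
      have hneg : neg (n + 1) a = neg n a + if a n = 2 then 1 else 0 := Finset.sum_range_succ ..
      have hdot (A j : ℕ) : dot A j (n + 1) a = dot A j n a + a n * (entry A n j : ZMod 3) :=
        Finset.sum_range_succ ..
      have h3 : a n = 0 ∨ a n = 1 ∨ a n = 2 := by
        generalize a n = x; revert x; decide
      -- As `2 = -1` modulo 3, adding `2 * entry` removes the contribution of a last entry 1, and
      -- adding `entry` that of a last entry 2.
      have key (A j v : ℕ) : (((v + 2 * entry A n j) % 3 : ℕ) : ZMod 3) =
          v - (entry A n j : ZMod 3) := by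
        rw [ZMod.natCast_mod]; push_cast
        rw [show (2 : ZMod 3) = -1 from rfl]; ring
      have key' (A j v : ℕ) : (((v + entry A n j) % 3 : ℕ) : ZMod 3) =
          v - 2 * (entry A n j : ZMod 3) := by
        rw [ZMod.natCast_mod]; push_cast
        rw [show (2 : ZMod 3) = -1 from rfl]; ring
      rcases h3 with h0 | h0 | h0
      · rw [hwt, h0] at ha
        obtain ⟨t, ht, h1, h2⟩ := ih (w + 1) (by simpa using ha)
        refine ⟨t, by rw [len_succ]; omega, fun A j v hv => ?_, fun v hv => ?_⟩
        · simp [hl, Nat.testBit_or, Nat.testBit_shiftLeft, h1 A j v hv, hdot, h0,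
            show ¬ len n (w + 1) ≤ t by omega, show ¬ len n (w + 1) + len n w ≤ t by omega]
        · simp [hp v hv, Nat.testBit_or, Nat.testBit_shiftLeft, h2 v hv, hneg, h0,
            show ¬ len n (w + 1) ≤ t by omega, show ¬ len n (w + 1) + len n w ≤ t by omega]
          rw [if_neg (by decide)]; simp
      · rw [hwt, h0, if_neg (by decide)] at ha
        obtain ⟨t, ht, h1, h2⟩ := ih w (by omega)
        refine ⟨len n (w + 1) + t, by rw [len_succ]; omega, fun A j v hv => ?_, fun v hv => ?_⟩
        · simp [hl, Nat.testBit_or, Nat.testBit_shiftLeft, testBit_lane_of_le, h1 A j _ (hm _),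
            hdot, h0, show ¬ len n w ≤ t by omega, key, eq_sub_iff_add_eq, -Nat.cast_add]
        · simp [hp v hv, Nat.testBit_or, Nat.testBit_shiftLeft, testBit_par_of_le, h2 v hv, hv,
            hneg, h0, show ¬ len n w ≤ t by omega]
          rw [if_neg (by decide)]; simp
      · rw [hwt, h0, if_neg (by decide)] at ha
        obtain ⟨t, ht, h1, h2⟩ := ih w (by omega)
        refine ⟨len n (w + 1) + len n w + t, by rw [len_succ]; omega,
          fun A j v hv => ?_, fun v hv => ?_⟩
        · have e1 : len n (w + 1) + len n w + t - len n (w + 1) = len n w + t := by omega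
          simp [hl, Nat.testBit_or, Nat.testBit_shiftLeft, e1,
            testBit_lane_of_le (show len n (w + 1) ≤ len n (w + 1) + len n w + t by omega),
            testBit_lane_of_le (show len n w ≤ len n w + t by omega), h1 A j _ (hm _),
            hdot, h0, key', eq_sub_iff_add_eq, -Nat.cast_add]
        · have e1 : len n (w + 1) + len n w + t - len n (w + 1) = len n w + t := by omega
          simp [hp v hv, Nat.testBit_or, Nat.testBit_shiftLeft, e1,
            testBit_par_of_le hv (show len n (w + 1) ≤ len n (w + 1) + len n w + t by omega),
            testBit_par_of_le hv (show len n w ≤ len n w + t by omega),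
            h2 (1 - v) (by omega), hneg, h0]
          omega

/-- The value of the bit-sliced binary counters at bit `t`. -/
def val (t : ℕ) : List ℕ → ℕ
  | [] => 0
  | b :: bs => (b.testBit t).toNat + 2 * val t bs

/-- Only an inequality, since a carry out of the top counter is lost; a lower bound for the number
of nonzero entries needs no more. -/
theorem val_inc_le (t : ℕ) (bs : List ℕ) (x : ℕ) :
    val t (inc bs x) ≤ val t bs + (x.testBit t).toNat := by
  induction bs generalizing x with
  | nil => exact Nat.zero_le _
  | cons b bs ih =>
    have h : val t (inc (b :: bs) x) =
        ((b ^^^ x).testBit t).toNat + 2 * val t (inc bs (b &&& x)) := rfl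
    have h' := ih (b &&& x)
    rw [h, val]
    rw [Nat.testBit_and] at h'
    rw [Nat.testBit_xor]
    cases hb : b.testBit t <;> cases hx : x.testBit t <;> simp [hb, hx] at h' ⊢ <;> omega

/-- For even `c`, `b + 2v ≥ c` means `v ≥ c / 2`. For odd `c` it means `v ≥ (c + 1) / 2`, or `b = 1`
and `v ≥ (c - 1) / 2`. -/
theorem le_val_of_testBit_ge {mask t : ℕ} {bs : List ℕ} {c : ℕ}
    (h : (ge mask bs c).testBit t = true) : c ≤ val t bs := by
  induction bs generalizing c with
  | nil =>
    cases c with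
    | zero => exact Nat.zero_le _
    | succ c => exact absurd h (by rw [show ge mask [] (c + 1) = 0 from rfl]; simp)
  | cons b bs ih =>
    rw [val]
    have hg : ge mask (b :: bs) c = Nat.rec (ge mask bs (c / 2))
      (fun _ _ => ge mask bs ((c + 1) / 2) ||| (b &&& ge mask bs (c / 2))) (c % 2) := rfl
    rw [hg] at h
    rcases Nat.mod_two_eq_zero_or_one c with h2 | h2
    · rw [h2] at h
      have := ih h
      omega
    · rw [h2] at h
      have h' : (ge mask bs ((c + 1) / 2) ||| (b &&& ge mask bs (c / 2))).testBit t = true := h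
      rw [Nat.testBit_or, Nat.testBit_and, Bool.or_eq_true, Bool.and_eq_true] at h'
      rcases h' with h' | ⟨hb, h'⟩
      · have := ih h'
        omega
      · have := ih h'
        rw [hb, Bool.toNat_true]
        omega

section Leading

variable {A m w t : ℕ} {a : ℕ → ZMod 3} (hA : ∀ j < 24, entry A m j < 3)
  (hl : ∀ A j v : ℕ, v < 3 → (lane A j m w v).testBit t = decide (dot A j m a = v))
include hA hl

theorem testBit_nz {j : ℕ} (hj : j < 24) : (nz A j m w (entry A m j)).testBit t =
    decide (dot A j m a + (entry A m j : ZMod 3) ≠ 0) := by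
  have h0 := hl A j 0 (by norm_num)
  have h1 := hl A j 1 (by norm_num)
  have h2 := hl A j 2 (by norm_num)
  generalize dot A j m a = x at *
  have := hA j hj
  generalize entry A m j = e at *
  interval_cases e
  · change (lane A j m w 1 ||| lane A j m w 2).testBit t = _
    rw [Nat.testBit_or, h1, h2]
    clear h0 h1 h2
    revert x; decide
  · change (lane A j m w 0 ||| lane A j m w 1).testBit t = _
    rw [Nat.testBit_or, h0, h1]
    clear h0 h1 h2
    revert x; decide
  · change (lane A j m w 0 ||| lane A j m w 2).testBit t = _
    rw [Nat.testBit_or, h0, h2]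
    clear h0 h1 h2
    revert x; decide

theorem testBit_minusOne {j : ℕ} (hj : j < 24) : (minusOne A j m w (entry A m j)).testBit t =
    decide (dot A j m a + (entry A m j : ZMod 3) = 2) := by
  have h0 := hl A j 0 (by norm_num)
  have h1 := hl A j 1 (by norm_num)
  have h2 := hl A j 2 (by norm_num)
  generalize dot A j m a = x at *
  have := hA j hj
  generalize entry A m j = e at *
  interval_cases e
  · refine h2.trans ?_
    clear h0 h1 h2
    revert x; decide
  · refine h1.trans ?_
    clear h0 h1 h2
    revert x; decide
  · refine h0.trans ?_
    clear h0 h1 h2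
    revert x; decide

theorem val_cnt_le {k : ℕ} (hk : k ≤ 24) : val t (cnt A m w k) ≤
    wt k fun j => dot A j m a + (entry A m j : ZMod 3) := by
  induction k with
  | zero => simp [cnt, val]
  | succ k ih =>
    have h : cnt A m w (k + 1) = inc (cnt A m w k) (nz A k m w (entry A m k)) := rfl
    rw [h, wt, Finset.sum_range_succ, ← wt]
    refine (val_inc_le ..).trans (add_le_add (ih (by omega)) ?_)
    rw [testBit_nz hA hl (by omega)]
    split_ifs with h0 <;> simp [h0]

theorem testBit_nzAll (ht : t < len m w) {k : ℕ} (hk : k ≤ 24) :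
    (∀ j < k, dot A j m a + (entry A m j : ZMod 3) ≠ 0) → (nzAll A m w k).testBit t = true := by
  induction k with
  | zero =>
    intro _
    have h : nzAll A m w 0 = 2 ^ len m w - 1 := rfl
    simpa [h, Nat.testBit_two_pow_sub_one] using ht
  | succ k ih =>
    intro h
    have e : nzAll A m w (k + 1) = nzAll A m w k &&& nz A k m w (entry A m k) := rfl
    rw [e, Nat.testBit_and, ih (by omega) fun j hj => h j (by omega), testBit_nz hA hl (by omega)]
    simpa using h k (by omega)

theorem testBit_oddAll (hp : (par m w 1).testBit t = decide (neg m a % 2 = 1))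
    {k : ℕ} (hk : k ≤ 24) : (oddAll A m w k).testBit t =
      decide ((neg m a + neg k fun j => dot A j m a + (entry A m j : ZMod 3)) % 2 = 1) := by
  induction k with
  | zero => simpa [oddAll, neg] using hp
  | succ k ih =>
    have e : oddAll A m w (k + 1) = oddAll A m w k ^^^ minusOne A k m w (entry A m k) := rfl
    have e' : (neg (k + 1) fun j => dot A j m a + (entry A m j : ZMod 3)) =
        (neg k fun j => dot A j m a + (entry A m j : ZMod 3)) +
          if dot A k m a + (entry A m k : ZMod 3) = 2 then 1 else 0 := Finset.sum_range_succ ..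
    rw [e, Nat.testBit_xor, ih (by omega), testBit_minusOne hA hl (by omega), e']
    generalize (neg k fun j => dot A j m a + (entry A m j : ZMod 3)) = x
    generalize neg m a = y
    split_ifs with h <;> simp only [h, decide_true, decide_false, Bool.xor_true, Bool.xor_false,
      add_zero]
    rw [← decide_not]
    exact decide_eq_decide.mpr (by omega)

end Leading

/-! ### From the numerical checks to all words -/

theorem le_wt_of_lightCheck {A m w : ℕ} (hA : ∀ j < 24, entry A m j < 3)
    (h : lightCheck A m w = true) {a : ℕ → ZMod 3} (ha : wt m a = w) :
    12 - w ≤ wt 24 fun j => dot A j m a + (entry A m j : ZMod 3) := by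
  obtain ⟨t, ht, hl, -⟩ := exists_lane m w a ha
  have h' : ge (2 ^ len m w - 1) (cnt A m w 24) (12 - w) = 2 ^ len m w - 1 := Nat.eq_of_beq_eq_true h
  refine le_trans (le_val_of_testBit_ge (mask := 2 ^ len m w - 1) (t := t) ?_)
    (val_cnt_le hA hl le_rfl)
  rw [h', Nat.testBit_two_pow_sub_one]
  simpa using ht

theorem even_of_parityCheck {A m w : ℕ} (hA : ∀ j < 24, entry A m j < 3)
    (h : parityCheck A m w = true) {a : ℕ → ZMod 3} (ha : wt m a = w)
    (hn : ∀ j < 24, dot A j m a + (entry A m j : ZMod 3) ≠ 0) :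
    Even (neg m a + neg 24 fun j => dot A j m a + (entry A m j : ZMod 3)) := by
  obtain ⟨t, ht, hl, hp⟩ := exists_lane m w a ha
  have h' : nzAll A m w 24 &&& oddAll A m w 24 = 0 := Nat.eq_of_beq_eq_true h
  have h1 := testBit_nzAll hA hl ht le_rfl hn
  have h2 := testBit_oddAll hA hl (by simpa using hp 1 (by norm_num)) le_rfl
  have h3 := congrArg (fun x => x.testBit t) h'
  simp only [Nat.testBit_and, h1, h2, Bool.true_and, Nat.zero_testBit, decide_eq_false_iff_not] at h3
  rw [Nat.even_iff]
  omega

theorem dot_smul (A j n : ℕ) (c : ZMod 3) (a : ℕ → ZMod 3) :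
    dot A j n (fun i => c * a i) = c * dot A j n a := by
  simp only [dot, Finset.mul_sum, mul_assoc]

theorem wt_smul (n : ℕ) {c : ZMod 3} (hc : c ≠ 0) (a : ℕ → ZMod 3) :
    wt n (fun i => c * a i) = wt n a := by
  simp only [wt, mul_eq_zero, hc, false_or]

theorem dot_of_leading {A j m n : ℕ} {a : ℕ → ZMod 3} (hm : m < n) (h1 : a m = 1)
    (h0 : ∀ i, m < i → i < n → a i = 0) : dot A j n a = dot A j m a + (entry A m j : ZMod 3) := by
  have : dot A j (m + 1) a = dot A j n a := by
    refine Finset.sum_subset (Finset.range_subset_range.mpr hm) fun i hi hi' => ?_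
    rw [h0 i (by simpa using hi') (Finset.mem_range.mp hi), zero_mul]
  rw [← this, dot, Finset.sum_range_succ, h1, one_mul, ← dot]

theorem wt_of_leading {m n : ℕ} {a : ℕ → ZMod 3} (hm : m < n) (h1 : a m ≠ 0)
    (h0 : ∀ i, m < i → i < n → a i = 0) : wt n a = wt m a + 1 := by
  have : wt (m + 1) a = wt n a := by
    refine Finset.sum_subset (Finset.range_subset_range.mpr hm) fun i hi hi' => ?_
    rw [h0 i (by simpa using hi') (Finset.mem_range.mp hi), if_pos rfl]
  rw [← this, wt, Finset.sum_range_succ, if_neg h1, ← wt]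

theorem exists_leading {n : ℕ} {a : ℕ → ZMod 3} (h : wt n a ≠ 0) :
    ∃ m < n, a m ≠ 0 ∧ ∀ i, m < i → i < n → a i = 0 := by
  induction n with
  | zero => exact absurd rfl h
  | succ n ih =>
    by_cases hn : a n = 0
    · have : wt (n + 1) a = wt n a := by rw [wt, Finset.sum_range_succ, if_pos hn, add_zero, ← wt]
      obtain ⟨m, hm, h1, h0⟩ := ih (this ▸ h)
      refine ⟨m, by omega, h1, fun i hi hi' => ?_⟩
      rcases Nat.lt_succ_iff_lt_or_eq.mp hi' with h | rfl
      · exact h0 i hi h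
      · exact hn
    · exact ⟨n, by omega, hn, fun i _ _ => by omega⟩

theorem lt_wt_add_wt {A : ℕ} (hA : ∀ m < 24, ∀ j < 24, entry A m j < 3)
    (h : ∀ m < 24, ∀ w < 6, lightCheck A m w = true) {a : ℕ → ZMod 3} (h0 : wt 24 a ≠ 0)
    (h6 : wt 24 a ≤ 6) : 12 < wt 24 a + wt 24 fun j => dot A j 24 a := by
  obtain ⟨m, hm, h1, hz⟩ := exists_leading h0
  have hw := wt_of_leading hm h1 hz
  -- Nonzero scalars are their own inverses, so multiplication by `a m` makes the last nonzero entry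
  -- 1 without changing weights.
  have hsq : a m * a m = 1 := by
    revert h1; generalize a m = x; revert x; decide
  have := le_wt_of_lightCheck (hA m hm) (h m hm _ (show wt m a < 6 by omega))
    (wt_smul m h1 a)
  rw [funext fun j => (dot_of_leading (A := A) (j := j) hm hsq
    fun i hi hi' => by rw [hz i hi hi', mul_zero]).symm] at this
  simp only [dot_smul, wt_smul _ h1] at this
  omega

/-- Negating a word with 48 nonzero entries turns `N` entries `-1` into `48 - N`, which has the same
parity; so the last coefficient may be taken to be 1. -/
theorem even_neg_add_neg {A : ℕ} (hA : ∀ m < 24, ∀ j < 24, entry A m j < 3)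
    (h : parityCheck A 23 23 = true) {a : ℕ → ZMod 3} (ha : ∀ i < 24, a i ≠ 0)
    (hd : ∀ j < 24, dot A j 24 a ≠ 0) : Even (neg 24 a + neg 24 fun j => dot A j 24 a) := by
  have main (a : ℕ → ZMod 3) (ha : ∀ i < 24, a i ≠ 0) (h1 : a 23 = 1)
      (hd : ∀ j < 24, dot A j 24 a ≠ 0) : Even (neg 24 a + neg 24 fun j => dot A j 24 a) := by
    have hdot (j : ℕ) := dot_of_leading (A := A) (j := j) (m := 23) (n := 24) (by norm_num) h1
      fun i _ _ => by omega
    have hwt : wt 23 a = 23 := by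
      rw [wt, Finset.sum_congr rfl fun i hi => if_neg (ha i ?_)]
      · simp
      · have := Finset.mem_range.mp hi; omega
    have hneg : neg 24 a = neg 23 a := by
      rw [neg, Finset.sum_range_succ, h1, if_neg (by decide), add_zero, ← neg]
    have := even_of_parityCheck (hA 23 (by norm_num)) h hwt fun j hj => hdot j ▸ hd j hj
    simpa only [hneg, hdot] using this
  have hsum (b : ℕ → ZMod 3) (hb : ∀ i < 24, b i ≠ 0) :
      neg 24 b + neg 24 (fun i => 2 * b i) = 24 := by
    rw [neg, neg, ← Finset.sum_add_distrib, Finset.sum_congr rfl (g := fun _ => 1)]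
    · simp
    · intro i hi
      have := hb i (Finset.mem_range.mp hi)
      revert this; generalize b i = x; revert x; decide
  have h23 : a 23 = 1 ∨ a 23 = 2 := by
    have := ha 23 (by norm_num)
    revert this; generalize a 23 = x; revert x; decide
  rcases h23 with h1 | h1
  · exact main a ha h1 hd
  · have h20 : (2 : ZMod 3) ≠ 0 := by decide
    have := main (fun i => 2 * a i) (fun i hi => mul_ne_zero h20 (ha i hi)) (by rw [h1]; rfl)
      fun j hj => by rw [dot_smul]; exact mul_ne_zero h20 (hd j hj)
    simp only [dot_smul] at this
    have e1 := hsum a ha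
    have e2 := hsum _ hd
    rw [Nat.even_iff] at this ⊢
    omega

end TernaryLanes

/-! ### Systematic ternary codes of length 48 -/

open TernaryLanes in
/-- The square matrix encoded by the base-4 digits of a natural number. -/
def digitMatrix (N : ℕ) : Matrix (Fin 24) (Fin 24) (ZMod 3) :=
  Matrix.of fun i j => (entry N i j : ZMod 3)

/-- Sum of the first `n` values. -/
def natSum (n : ℕ) (f : ℕ → ℕ) : ℕ := Nat.rec 0 (fun k ih => Nat.add ih (f k)) n

open TernaryLanes in
def productCheck (n : ℕ) (f g t : ℕ → ℕ → ℕ) : Bool :=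
  all n fun i => all 24 fun k =>
    Nat.beq (Nat.mod (natSum 24 fun j => Nat.mul (f i j) (g j k)) 3) (Nat.mod (t i k) 3)

theorem natSum_eq (n : ℕ) (f : ℕ → ℕ) : natSum n f = ∑ i ∈ Finset.range n, f i := by
  induction n with
  | zero => rfl
  | succ n ih => rw [Finset.sum_range_succ, ← ih]; rfl

open TernaryLanes in
theorem sum_eq_of_productCheck {n : ℕ} {f g t : ℕ → ℕ → ℕ} (h : productCheck n f g t = true)
    {i k : ℕ} (hi : i < n) (hk : k < 24) :
    ∑ j : Fin 24, (f i j : ZMod 3) * (g j k : ZMod 3) = t i k := by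
  have h' := Nat.eq_of_beq_eq_true (all_eq_true (all_eq_true h hi) hk)
  have h'' := (ZMod.natCast_eq_natCast_iff' _ _ 3).mpr h'
  rw [natSum_eq, Finset.sum_range] at h''
  rw [← h'', Nat.cast_sum]
  exact Finset.sum_congr rfl fun j _ => (Nat.cast_mul _ _).symm

theorem beq_eq_false_of_ne {i k : Fin 24} (h : i ≠ k) : Nat.beq i k = false := by
  rw [← Bool.not_eq_true, Nat.beq_eq]
  exact Fin.val_ne_of_ne h

section Digits

open TernaryLanes

/-- Extension of a word by zeros. -/
def extendZero (a : Fin 24 → ZMod 3) (i : ℕ) : ZMod 3 := if h : i < 24 then a ⟨i, h⟩ else 0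

theorem extendZero_coe (a : Fin 24 → ZMod 3) (i : Fin 24) : extendZero a i = a i := by
  simp [extendZero]

theorem wt_eq_hammingNorm {b : ℕ → ZMod 3} {a : Fin 24 → ZMod 3} (h : ∀ i : Fin 24, b i = a i) :
    wt 24 b = hammingNorm a := by
  rw [wt, Finset.sum_range, hammingNorm, Finset.card_filter]
  exact Finset.sum_congr rfl fun i _ => by rw [h i]; split_ifs <;> simp_all

theorem neg_eq_card {b : ℕ → ZMod 3} {a : Fin 24 → ZMod 3} (h : ∀ i : Fin 24, b i = a i) :
    neg 24 b = Finset.card {i | a i = 2} := by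
  rw [neg, Finset.sum_range, Finset.card_filter]
  exact Finset.sum_congr rfl fun i _ => by rw [h i]

theorem dot_eq_vecMul (N : ℕ) (a : Fin 24 → ZMod 3) (j : Fin 24) :
    dot N j 24 (extendZero a) = Matrix.vecMul a (digitMatrix N) j := by
  rw [dot, Finset.sum_range, Matrix.vecMul, dotProduct]
  exact Finset.sum_congr rfl fun i _ => by rw [extendZero_coe]; rfl

variable {N : ℕ} (hN : ∀ m < 24, ∀ j < 24, entry N m j < 3)
include hN

theorem lt_hammingNorm_add_of_le (h : ∀ m < 24, ∀ w < 6, lightCheck N m w = true)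
    {a : Fin 24 → ZMod 3} (h0 : a ≠ 0) (h6 : hammingNorm a ≤ 6) :
    12 < hammingNorm a + hammingNorm (Matrix.vecMul a (digitMatrix N)) := by
  have e1 := wt_eq_hammingNorm (extendZero_coe a)
  have e2 := wt_eq_hammingNorm (b := fun j => dot N j 24 (extendZero a)) (dot_eq_vecMul N a)
  have := lt_wt_add_wt hN h (a := extendZero a) (by rwa [e1, hammingNorm_ne_zero_iff]) (by rwa [e1])
  rwa [e1, e2] at this

theorem even_card_add_card (h : parityCheck N 23 23 = true) {a : Fin 24 → ZMod 3}
    (ha : ∀ i, a i ≠ 0) (hd : ∀ j, Matrix.vecMul a (digitMatrix N) j ≠ 0) :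
    Even (Finset.card {i | a i = 2} +
      Finset.card {j | Matrix.vecMul a (digitMatrix N) j = 2}) := by
  rw [← neg_eq_card (extendZero_coe a),
    ← neg_eq_card (b := fun j => dot N j 24 (extendZero a)) (dot_eq_vecMul N a)]
  refine even_neg_add_neg hN h (fun i hi => ?_) fun j hj => ?_
  · exact (extendZero_coe a ⟨i, hi⟩).symm ▸ ha _
  · exact (dot_eq_vecMul N a ⟨j, hj⟩).symm ▸ hd _

end Digits

/-- After the coordinate permutation `σ`, the words of the code `C` are the words `(a, a A)`. -/
def IsSystematic (C : Submodule (ZMod 3) (Fin 48 → ZMod 3)) (A : Matrix (Fin 24) (Fin 24) (ZMod 3))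
    (σ : Fin 24 ⊕ Fin 24 ≃ Fin 48) : Prop :=
  ∀ c, c ∈ C ↔ ∀ j, c (σ (Sum.inr j)) = Matrix.vecMul (fun i => c (σ (Sum.inl i))) A j

/-- The facts about the code that enter into the minimal norm of the lattice. -/
structure IsGoodCode (C : Submodule (ZMod 3) (Fin 48 → ZMod 3)) : Prop where
  lt_hammingNorm : ∀ c ∈ C, c ≠ 0 → 12 < hammingNorm c
  sum_sq : ∀ c ∈ C, ∑ i, c i ^ 2 = 0
  even_card : ∀ c ∈ C, (∀ i, c i ≠ 0) → Even (Finset.card {i | c i = 2})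
  card_eq : Nat.card C = 3 ^ 24
  exists_mem : ∃ e : Fin 4 → Fin 48, Function.Injective e ∧
    ∀ x : Fin 4 → ZMod 3, ∃ c ∈ C, ∀ i, c (e i) = x i

theorem hammingNorm_diagonal {d : Fin 24 → ZMod 3} (hd : ∀ i, d i ≠ 0) (a : Fin 24 → ZMod 3) :
    hammingNorm (Matrix.vecMul a (Matrix.diagonal d)) = hammingNorm a := by
  simp only [hammingNorm, Matrix.vecMul_diagonal]
  congr 1
  ext i
  simp [hd i]

theorem hammingNorm_comp_equiv (c : Fin 48 → ZMod 3) (σ : Fin 24 ⊕ Fin 24 ≃ Fin 48) :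
    hammingNorm c = hammingNorm (fun i => c (σ (Sum.inl i))) +
      hammingNorm (fun j => c (σ (Sum.inr j))) := by
  simp only [hammingNorm, Finset.card_filter]
  rw [← Equiv.sum_comp σ, Fintype.sum_sum_type]

theorem card_filter_comp_equiv (c : Fin 48 → ZMod 3) (σ : Fin 24 ⊕ Fin 24 ≃ Fin 48) :
    Finset.card {i | c i = 2} = Finset.card {i | c (σ (Sum.inl i)) = 2} +
      Finset.card {j | c (σ (Sum.inr j)) = 2} := by
  simp only [Finset.card_filter]
  rw [← Equiv.sum_comp σ, Fintype.sum_sum_type]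

namespace IsSystematic

variable {C : Submodule (ZMod 3) (Fin 48 → ZMod 3)} {A : Matrix (Fin 24) (Fin 24) (ZMod 3)}
  {σ : Fin 24 ⊕ Fin 24 ≃ Fin 48} (h : IsSystematic C A σ)
include h

theorem bijective : Function.Bijective fun (c : C) (i : Fin 24) =>
    (c : Fin 48 → ZMod 3) (σ (Sum.inl i)) := by
  constructor
  · intro c c' hc
    have hc' (i : Fin 24) := congrFun hc i
    refine Subtype.ext (funext fun i => ?_)
    obtain ⟨i | j, rfl⟩ := σ.surjective i
    · exact hc' i
    · rw [(h c).mp c.2 j, (h c').mp c'.2 j]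
      exact congrArg (fun a => Matrix.vecMul a A j) hc
  · intro a
    let c : Fin 48 → ZMod 3 := fun i => Sum.elim a (Matrix.vecMul a A) (σ.symm i)
    exact ⟨⟨c, (h c).mpr fun j => by simp [c]⟩, by ext i; simp [c]⟩

-- Self-orthogonality is `A * Aᵀ = -1`. By `hde`, with `(a, aA)` also `(aAD, aE)` is a codeword,
-- where `D` and `E` are the diagonal matrices of `d` and `e`. The halves are thus exchanged up to
-- signs, and a light word has a light left half after an exchange at most.
open TernaryLanes in
theorem isGoodCode {N : ℕ} (hA : A = digitMatrix N) (hN : ∀ m < 24, ∀ j < 24, entry N m j < 3)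
    (hl : ∀ m < 24, ∀ w < 6, lightCheck N m w = true) (hp : parityCheck N 23 23 = true)
    {d e : Fin 24 → ZMod 3} (hd : ∀ i, d i ≠ 0) (he : ∀ i, e i ≠ 0)
    (hde : A * Matrix.diagonal d * A = Matrix.diagonal e)
    (ho : productCheck 24 (entry N) (fun j k => entry N k j)
      (fun i k => cond (Nat.beq i k) 2 0) = true) : IsGoodCode C where
  sum_sq c hc := by
    have ho' : A * A.transpose = -1 := by
      ext i k
      rw [Matrix.mul_apply, hA]
      refine (sum_eq_of_productCheck ho i.2 k.2).trans ?_
      rcases eq_or_ne i k with rfl | hik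
      · rw [Matrix.neg_apply, Matrix.one_apply_eq, Nat.beq_refl, cond_true]
        rfl
      · rw [Matrix.neg_apply, Matrix.one_apply_ne hik, beq_eq_false_of_ne hik, cond_false,
          Nat.cast_zero, neg_zero]
    have h1 (a : Fin 24 → ZMod 3) : ∑ i, a i ^ 2 + ∑ j, Matrix.vecMul a A j ^ 2 = 0 := by
      have h2 : ∑ j, Matrix.vecMul a A j ^ 2 = Matrix.vecMul a A ⬝ᵥ Matrix.vecMul a A :=
        Finset.sum_congr rfl fun j _ => sq _
      have h3 : ∑ i, a i ^ 2 = a ⬝ᵥ a := Finset.sum_congr rfl fun j _ => sq _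
      rw [h2, h3, ← Matrix.dotProduct_mulVec, ← Matrix.vecMul_transpose, Matrix.vecMul_vecMul, ho',
        Matrix.vecMul_neg, Matrix.vecMul_one, dotProduct_neg, add_neg_cancel]
    rw [← Equiv.sum_comp σ, Fintype.sum_sum_type]
    simp only [(h c).mp hc]
    exact h1 _
  lt_hammingNorm c hc h0 := by
    rw [hammingNorm_comp_equiv c σ]
    have hb : (fun j => c (σ (Sum.inr j))) = Matrix.vecMul (fun i => c (σ (Sum.inl i))) A :=
      funext ((h c).mp hc)
    have ha0 : (fun i => c (σ (Sum.inl i))) ≠ 0 := by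
      intro ha
      rw [ha, Matrix.zero_vecMul] at hb
      refine h0 (funext fun i => ?_)
      obtain ⟨i | j, rfl⟩ := σ.surjective i
      · exact congrFun ha i
      · exact congrFun hb j
    rw [hb]
    generalize (fun i => c (σ (Sum.inl i))) = a at ha0
    by_contra hlt
    rcases le_or_gt (hammingNorm a) 6 with h6 | h6
    · exact hlt (hA ▸ lt_hammingNorm_add_of_le hN hl ha0 h6)
    -- The left half has weight above 6 in a word of weight at most 12, so the right half has weight
    -- below 6 and becomes the left half of the exchanged word.
    · set b := Matrix.vecMul (Matrix.vecMul a A) (Matrix.diagonal d) with hbdef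
      have hbA : Matrix.vecMul b A = Matrix.vecMul a (Matrix.diagonal e) := by
        rw [hbdef, Matrix.vecMul_vecMul, Matrix.vecMul_vecMul, ← Matrix.mul_assoc, hde]
      have hb0 : b ≠ 0 := by
        intro hb
        rw [hb, Matrix.zero_vecMul] at hbA
        apply ha0
        rw [← hammingNorm_eq_zero, ← hammingNorm_diagonal he, ← hbA, hammingNorm_zero]
      have hbn : hammingNorm b = hammingNorm (Matrix.vecMul a A) := hammingNorm_diagonal hd _
      have := lt_hammingNorm_add_of_le hN hl hb0 (by omega)
      rw [← hA, hbA, hammingNorm_diagonal he] at this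
      omega
  even_card c hc h0 := by
    rw [card_filter_comp_equiv c σ]
    have hb (j : Fin 24) : c (σ (Sum.inr j)) =
        Matrix.vecMul (fun i => c (σ (Sum.inl i))) (digitMatrix N) j := hA ▸ (h c).mp hc j
    simp only [hb]
    exact even_card_add_card hN hp (fun i => h0 _) fun j => hb j ▸ h0 _
  card_eq := by
    rw [Nat.card_congr (Equiv.ofBijective _ h.bijective)]
    simp
  exists_mem := by
    refine ⟨fun i => σ (Sum.inl (Fin.castLE (by norm_num) i)), fun i j hij => ?_, fun x => ?_⟩
    · simpa using hij
    · obtain ⟨c, hc⟩ := h.bijective.2 fun i => if hi : (i : ℕ) < 4 then x ⟨i, hi⟩ else 0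
      refine ⟨c, c.2, fun i => ?_⟩
      have := congrFun hc (Fin.castLE (by norm_num) i)
      simpa using this

end IsSystematic

/-! ### The Pless symmetry code -/

open TernaryLanes

theorem mul_diagonal_mul_of_check {N : ℕ} {d e : ℕ → ℕ} {d' e' : Fin 24 → ZMod 3}
    (hd : ∀ i, d' i = (d i : ℕ)) (he : ∀ i, e' i = (e i : ℕ))
    (h : productCheck 24 (entry N) (fun j k => Nat.mul (d j) (entry N j k))
      (fun i k => cond (Nat.beq i k) (e i) 0) = true) :
    digitMatrix N * Matrix.diagonal d' * digitMatrix N = Matrix.diagonal e' := by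
  ext i k
  rw [Matrix.mul_assoc, Matrix.mul_apply]
  have := sum_eq_of_productCheck h i.2 k.2
  simp only [Nat.mul_eq, Nat.cast_mul] at this
  simp only [Matrix.diagonal_mul, hd]
  refine this.trans ?_
  rcases eq_or_ne i k with rfl | hik
  · rw [Matrix.diagonal_apply_eq, he, Nat.beq_refl, cond_true]
  · have hne : Nat.beq i k = false := beq_eq_false_of_ne hik
    rw [Matrix.diagonal_apply_ne _ hik, hne, cond_false, Nat.cast_zero]

/-- The bordered Paley matrix row by row, starting from the lowest digit, with 2 for `-1`. -/
def plessDigits : ℕ :=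
  0x2a99a5a599564aa66969665652a99a5a599654aa66969666552a99a5a59a954aa66969666552a99a5a5a9954aa66969666552a99a5a659954aa6696a966552a99a5aa59954aa66966966552a99a65a59954aa66a96966552a99aa5a59954aa66696966552a9a9a5a59954aa66696966552aa99a5a59954aaa6696966552aa99a5a59954aaa6696966552555555555554

theorem entry_plessDigits_lt : ∀ m < 24, ∀ j < 24, entry plessDigits m j < 3 := by
  decide +kernel

theorem lightCheck_plessDigits :
    (all 24 fun m => all 6 fun w => lightCheck plessDigits m w) = true := by
  decide +kernel

theorem parityCheck_plessDigits : parityCheck plessDigits 23 23 = true := by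
  decide +kernel

/-- The constant is the table of the quadratic character on the 23 residues, two bits each, with 2
for `-1`. -/
theorem quadraticChar_zmod23 : ∀ x : ZMod 23, ((quadraticChar (ZMod 23) x : ℤ) : ZMod 3) =
    (Nat.mod (Nat.shiftRight 0x2a99a5a59954 (Nat.mul 2 x.val)) 4 : ℕ) := by
  decide +kernel

theorem entry_plessDigits_succ : ∀ i j : Fin 23, entry plessDigits (i + 1) (j + 1) =
    Nat.mod (Nat.shiftRight 0x2a99a5a59954
      (Nat.mul 2 (((j : ℕ) : ZMod 23) - ((i : ℕ) : ZMod 23)).val)) 4 := by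
  decide +kernel

theorem plessMatrix_eq : plessMatrix = digitMatrix plessDigits := by
  ext i j
  refine Fin.cases ?_ (fun i => ?_) i
  · revert j; decide +kernel
  · refine Fin.cases ?_ (fun j => ?_) j
    · revert i; decide +kernel
    · refine (quadraticChar_zmod23 _).trans ?_
      rw [← entry_plessDigits_succ]
      rfl

/-- The conceptual reason: `S` is skew-symmetric, as 23 is 3 modulo 4, and `S Sᵀ = 23 = -1` modulo
3, so `S² = 1`. -/
theorem plessMatrix_mul :
    plessMatrix * Matrix.diagonal 1 * plessMatrix = Matrix.diagonal 1 := by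
  rw [plessMatrix_eq]
  exact mul_diagonal_mul_of_check (d := fun _ => 1) (e := fun _ => 1)
    (fun _ => Nat.cast_one.symm) (fun _ => Nat.cast_one.symm) (by decide +kernel)

theorem sum_smul_append (a : Fin 24 → ZMod 3) (A : Matrix (Fin 24) (Fin 24) (ZMod 3)) :
    ∑ k, a k • (Fin.append (Pi.single k (1 : ZMod 3)) (A k) : Fin (24 + 24) → ZMod 3) =
      Fin.append a (Matrix.vecMul a A) := by
  funext i
  induction i using Fin.addCases with
  | left i =>
    simp only [Finset.sum_apply, Pi.smul_apply, smul_eq_mul, Fin.append_left, Pi.single_apply]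
    simp
  | right j =>
    simp only [Finset.sum_apply, Pi.smul_apply, smul_eq_mul, Fin.append_right, Matrix.vecMul,
      dotProduct]

theorem isSystematic_plessCode48 : IsSystematic plessCode48 plessMatrix finSumFinEquiv := by
  intro c
  have hl (i : Fin 24) : (finSumFinEquiv (Sum.inl i) : Fin (24 + 24)) = Fin.castAdd 24 i := rfl
  have hr (i : Fin 24) : (finSumFinEquiv (Sum.inr i) : Fin (24 + 24)) = Fin.natAdd 24 i := rfl
  rw [plessCode48, Submodule.mem_span_range_iff_exists_fun]
  simp only [sum_smul_append]
  constructor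
  · rintro ⟨a, rfl⟩ j
    rw [hr, Fin.append_right]
    congr 1
    funext i
    rw [hl, Fin.append_left]
  · intro h
    refine ⟨fun i => c (finSumFinEquiv (m := 24) (n := 24) (Sum.inl i)), ?_⟩
    refine funext fun i : Fin (24 + 24) => ?_
    induction i using Fin.addCases with
    | left i => rw [Fin.append_left, hl]
    | right j => rw [Fin.append_right, ← h j, hr]

theorem isGoodCode_plessCode48 : IsGoodCode plessCode48 :=
  isSystematic_plessCode48.isGoodCode plessMatrix_eq entry_plessDigits_lt
    (fun _ hm _ hw => all_eq_true (all_eq_true lightCheck_plessDigits hm) hw)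
    parityCheck_plessDigits (fun _ => one_ne_zero) (fun _ => one_ne_zero) plessMatrix_mul
    (by decide +kernel)

/-! ### The extended quadratic residue code -/

/-- The right half of the systematic generator matrix for the coordinate order `qrOrder`. -/
def qrDigits : ℕ :=
  0xa25859a6a5228961669a948a25859a6a522a961669a948a25859a6a5228a61669a948a26859a6a5228961669a948a25a59a6a5228962669a948a25869a6a5228961669a948a2585aa6a5228961669a948a25859a6a522896166aa948a25859a6a5228961669a948a25859a6a5228961669aa48a25859a6a6228961669a968a25859a6a5228961669a94a555555555554

theorem entry_qrDigits_lt : ∀ m < 24, ∀ j < 24, entry qrDigits m j < 3 := by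
  decide +kernel

theorem lightCheck_qrDigits :
    (all 24 fun m => all 6 fun w => lightCheck qrDigits m w) = true := by
  decide +kernel

theorem parityCheck_qrDigits : parityCheck qrDigits 23 23 = true := by
  decide +kernel

/-- This reflects the monomial automorphism of Gleason and Prange over `x ↦ -1/x`. It exchanges `0`
with `∞` and the square `25 ^ k` with the nonsquare `-1 / 25 ^ k`; its signs give the diagonal
matrices. -/
theorem digitMatrix_qrDigits_mul :
    digitMatrix qrDigits * Matrix.diagonal (Fin.cons 2 fun _ => 1) * digitMatrix qrDigits =
      Matrix.diagonal (Fin.cons 1 fun _ => 2) :=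
  mul_diagonal_mul_of_check (d := fun i => Nat.rec 2 (fun _ _ => 1) i)
    (e := fun i => Nat.rec 1 (fun _ _ => 2) i) (by decide) (by decide) (by decide +kernel)

/-- The coordinates in an order adapted to the multiplication by the squares modulo 47: first `0`
and the squares `25 ^ k`, then `∞` and the nonsquares `-1 / 25 ^ k`. -/
def qrOrder : Fin 24 ⊕ Fin 24 → Fin 48 :=
  -- Coordinate 0 is `∞` and the residue `x` has coordinate `x + 1`; modulo 47, `46 = -1` and `32`
  -- is the inverse of `25`.
  Sum.elim (Fin.cons 1 fun k => Fin.ofNat 48 (25 ^ (k : ℕ) % 47 + 1))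
    (Fin.cons 0 fun k => Fin.ofNat 48 (46 * 32 ^ (k : ℕ) % 47 + 1))

/-- The matrix of the permutation `qrOrder`. -/
noncomputable def qrEquiv : Fin 24 ⊕ Fin 24 ≃ Fin 48 :=
  Equiv.ofBijective qrOrder ((Fintype.bijective_iff_injective_and_card _).mpr
    ⟨by decide +kernel, by simp⟩)

/-- The indicator vector of the nonzero squares modulo 47, shifted by `j`, with its parity check. -/
def qrWord (j : ℕ) (i : ℕ) : ℕ :=
  -- The parity entry is 1 because there are 23 nonzero squares and `23 + 1` vanishes modulo 3. The
  -- constant has its bits at these squares.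
  Nat.casesOn i 1 fun i => Nat.mod (Nat.shiftRight 0x4351b2753de (Nat.mod (i + 47 - j) 47)) 2

theorem isSquare_zmod47 : ∀ x : ZMod 47, (if x ≠ 0 ∧ IsSquare x then (1 : ZMod 3) else 0) =
    (Nat.mod (Nat.shiftRight 0x4351b2753de x.val) 2 : ℕ) := by
  decide +kernel

theorem qrWord_succ_val : ∀ i j : Fin 47, qrWord j (i + 1) =
    Nat.mod (Nat.shiftRight 0x4351b2753de (((i : ℕ) : ZMod 47) - ((j : ℕ) : ZMod 47)).val) 2 := by
  decide +kernel

theorem qrWord_succ (j : ZMod 47) (i : Fin 47) : (qrWord j.val (i + 1) : ZMod 3) =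
    if ((i : ℕ) : ZMod 47) ≠ j ∧ IsSquare (((i : ℕ) : ZMod 47) - j) then (1 : ZMod 3) else 0 := by
  have h := qrWord_succ_val i ⟨j.val, ZMod.val_lt j⟩
  simp only [ZMod.natCast_zmod_val] at h
  rw [h, ← isSquare_zmod47]
  simp only [sub_ne_zero]

/-- The left half of `qrOrder`. -/
def qrLeft (i : ℕ) : ℕ := Nat.rec 1 (fun k _ => Nat.add (Nat.mod (Nat.pow 25 k) 47) 1) i

/-- The right half of `qrOrder`. -/
def qrRight (i : ℕ) : ℕ :=
  Nat.rec 0 (fun k _ => Nat.add (Nat.mod (Nat.mul 46 (Nat.pow 32 k)) 47) 1) i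

theorem qrOrder_inl : ∀ i : Fin 24, (qrOrder (Sum.inl i) : ℕ) = qrLeft i := by decide +kernel

theorem qrOrder_inr : ∀ i : Fin 24, (qrOrder (Sum.inr i) : ℕ) = qrRight i := by decide +kernel

theorem productCheck_qrWord : productCheck 47 (fun j i => qrWord j (qrLeft i)) (entry qrDigits)
    (fun j k => qrWord j (qrRight k)) = true := by
  decide +kernel

theorem qrWord_parity (j : Fin 47) (k : Fin 24) :
    (qrWord j (qrOrder (Sum.inr k)) : ZMod 3) = Matrix.vecMul
      (fun i => (qrWord j (qrOrder (Sum.inl i)) : ZMod 3)) (digitMatrix qrDigits) k := by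
  simp only [qrOrder_inl, qrOrder_inr]
  exact (sum_eq_of_productCheck productCheck_qrWord j.2 k.2).symm

theorem sum_qrWord : ∀ j : Fin 47, ∑ i : Fin 48, (qrWord j i : ZMod 3) = 0 := by
  decide +kernel

/-- The inverse of the matrix formed by the first 24 coordinates, in the order `qrOrder`, of the
first 24 words `qrWord`. -/
def qrInverseDigits : ℕ :=
  0x16259946a65864952108a4850a2425a5a99521a60a664914548298009494909822a59248412526a40988919a1509a81800614046628a1491814480522140619626558954060226808194465620411a18a2a221245a220625291906618668809a0a420668aa15885414680a68aa6aa4aaa591448258459a6611001a684a69a60291aa90a4814a04112040541518812481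

theorem productCheck_qrInverse : productCheck 24 (entry qrInverseDigits)
    (fun j i => qrWord j (qrLeft i)) (fun i k => cond (Nat.beq i k) 1 0) = true := by
  decide +kernel

theorem qrInverse_mul : digitMatrix qrInverseDigits *
    Matrix.of (fun j i : Fin 24 => (qrWord j (qrOrder (Sum.inl i)) : ZMod 3)) = 1 := by
  ext i k
  rw [Matrix.mul_apply]
  simp only [Matrix.of_apply, qrOrder_inl]
  refine (sum_eq_of_productCheck productCheck_qrInverse i.2 k.2).trans ?_
  rcases eq_or_ne i k with rfl | hik
  · rw [Matrix.one_apply_eq, Nat.beq_refl, cond_true, Nat.cast_one]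
  · have hne : Nat.beq i k = false := beq_eq_false_of_ne hik
    rw [Matrix.one_apply_ne hik, hne, cond_false, Nat.cast_zero]

theorem qrWord_mem (j : Fin 47) : (fun i : Fin 48 => (qrWord j i : ZMod 3)) ∈ extendedQRCode48 := by
  refine ⟨sum_qrWord j, Submodule.subset_span ⟨(j : ℕ), ?_⟩⟩
  funext i
  have hj : ((j : ℕ) : ZMod 47).val = j := ZMod.val_cast_of_lt j.2
  change (if ((i : ℕ) : ZMod 47) ≠ ((j : ℕ) : ZMod 47) ∧ _ then (1 : ZMod 3) else 0) = _
  rw [← qrWord_succ, hj]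
  simp only [Fin.val_succ]

theorem eq_cons_of_mem_extendedQRCode48 {c : Fin 48 → ZMod 3} (hc : c ∈ extendedQRCode48) :
    c = Fin.cons (-∑ i : Fin 47, c i.succ) fun i : Fin 47 => c i.succ := by
  have h : ∑ i, c i = 0 := hc.1
  rw [Fin.sum_univ_succ] at h
  funext i
  refine Fin.cases ?_ (fun i => ?_) i
  · rw [Fin.cons_zero]
    exact eq_neg_of_add_eq_zero_left h
  · rw [Fin.cons_succ]

/-- A word of the extended code is the image under `f` of its last 47 coordinates, and `g` measures
the failure of the check. Both are linear, so it suffices to treat the cyclic shifts that span the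
code. -/
theorem parity_of_mem_extendedQRCode48 {c : Fin 48 → ZMod 3} (hc : c ∈ extendedQRCode48)
    (k : Fin 24) : c (qrOrder (Sum.inr k)) =
      Matrix.vecMul (fun i => c (qrOrder (Sum.inl i))) (digitMatrix qrDigits) k := by
  let f : (Fin 47 → ZMod 3) →ₗ[ZMod 3] (Fin 48 → ZMod 3) :=
    { toFun := fun w => Fin.cons (-∑ i, w i) w
      map_add' := fun x y => by
        funext i
        refine Fin.cases ?_ (fun i => ?_) i
        · simp [Finset.sum_add_distrib, add_comm]
        · simp
      map_smul' := fun a x => by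
        funext i
        refine Fin.cases ?_ (fun i => ?_) i
        · simp [Finset.mul_sum]
        · simp }
  let g : (Fin 48 → ZMod 3) →ₗ[ZMod 3] ZMod 3 :=
    LinearMap.proj (qrOrder (Sum.inr k)) - (LinearMap.proj k).comp
      ((Matrix.vecMulLinear (digitMatrix qrDigits)).comp
        (LinearMap.funLeft (ZMod 3) (ZMod 3) fun i => qrOrder (Sum.inl i)))
  have hg (c : Fin 48 → ZMod 3) : g c = c (qrOrder (Sum.inr k)) -
      Matrix.vecMul (fun i => c (qrOrder (Sum.inl i))) (digitMatrix qrDigits) k := rfl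
  have hle : qrCode47 ≤ LinearMap.ker (g.comp f) := by
    refine Submodule.span_le.mpr ?_
    rintro _ ⟨j, rfl⟩
    rw [SetLike.mem_coe, LinearMap.mem_ker, LinearMap.comp_apply]
    have hm := qrWord_mem ⟨j.val, ZMod.val_lt j⟩
    have he := eq_cons_of_mem_extendedQRCode48 hm
    have hfe : f (fun i : Fin 47 =>
        if ((i : ℕ) : ZMod 47) ≠ j ∧ IsSquare (((i : ℕ) : ZMod 47) - j) then (1 : ZMod 3) else 0) =
        fun i : Fin 48 => (qrWord j.val i : ZMod 3) := by
      rw [he]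
      simp only [Fin.val_succ, qrWord_succ]
      rfl
    rw [hfe, hg, sub_eq_zero]
    exact qrWord_parity ⟨j.val, ZMod.val_lt j⟩ k
  have := hle hc.2
  rw [LinearMap.mem_ker, LinearMap.comp_apply] at this
  have hfc : f (fun i : Fin 47 => c i.succ) = c := (eq_cons_of_mem_extendedQRCode48 hc).symm
  rw [hfc, hg, sub_eq_zero] at this
  exact this

/-- For the converse, the left halves of the first 24 shifts form an invertible matrix, so some
codeword `c'` has the left half of `c`. The checks determine the right half from the left one, hence
`c' = c`. -/
theorem isSystematic_extendedQRCode48 :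
    IsSystematic extendedQRCode48 (digitMatrix qrDigits) qrEquiv := by
  refine fun c => ⟨fun hc k => parity_of_mem_extendedQRCode48 hc k, fun h => ?_⟩
  let b : Fin 24 → ZMod 3 :=
    Matrix.vecMul (fun i => c (qrOrder (Sum.inl i))) (digitMatrix qrInverseDigits)
  let c' : Fin 48 → ZMod 3 :=
    ∑ j : Fin 24, b j • fun i : Fin 48 => (qrWord (Fin.castLE (by norm_num) j : Fin 47) i : ZMod 3)
  have hc' : c' ∈ extendedQRCode48 := sum_mem fun j _ => Submodule.smul_mem _ _ (qrWord_mem _)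
  have hleft : (fun i => c' (qrOrder (Sum.inl i))) = fun i => c (qrOrder (Sum.inl i)) := by
    have : (fun i => c' (qrOrder (Sum.inl i))) = Matrix.vecMul b
        (Matrix.of (fun j i : Fin 24 => (qrWord j (qrOrder (Sum.inl i)) : ZMod 3))) := by
      funext i
      simp [c', Matrix.vecMul, dotProduct, Finset.sum_apply]
    rw [this, Matrix.vecMul_vecMul, qrInverse_mul, Matrix.vecMul_one]
  suffices c' = c from this ▸ hc'
  funext i
  obtain ⟨i | j, rfl⟩ := qrEquiv.surjective i
  · exact congrFun hleft i
  · rw [h j]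
    refine (parity_of_mem_extendedQRCode48 hc' j).trans ?_
    rw [hleft]
    rfl

theorem isGoodCode_extendedQRCode48 : IsGoodCode extendedQRCode48 :=
  isSystematic_extendedQRCode48.isGoodCode rfl entry_qrDigits_lt
    (fun _ hm _ hw => all_eq_true (all_eq_true lightCheck_qrDigits hm) hw)
    parityCheck_qrDigits (by decide) (by decide) digitMatrix_qrDigits_mul
    (by decide +kernel)

/-! ### The minimal norm -/

theorem norm_sq_of_eq_div {v : EuclideanSpace ℝ (Fin 48)} {x : Fin 48 → ℤ}
    (h : ∀ i, v i = (x i : ℝ) / √12) : ‖v‖ ^ 2 = ((∑ i, x i ^ 2 : ℤ) : ℝ) / 12 := by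
  rw [EuclideanSpace.norm_sq_eq]
  push_cast
  rw [Finset.sum_div]
  refine Finset.sum_congr rfl fun i _ => ?_
  rw [h i, Real.norm_eq_abs, sq_abs, div_pow, Real.sq_sqrt (by norm_num)]

theorem mem_ternaryCodeLattice_of_six {C : Submodule (ZMod 3) (Fin 48 → ZMod 3)}
    {v : EuclideanSpace ℝ (Fin 48)} {z : Fin 48 → ℤ} (h : ∀ i, v i = (6 * z i : ℝ) / √12)
    (hz : Even (∑ i, z i)) : v ∈ ternaryCodeLattice C := by
  refine ⟨fun i => 6 * z i, 0, fun i => by simp [h i], fun i => ?_, ?_, ?_⟩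
  · exact (Int.modEq_zero_iff_dvd.mpr ⟨3 * z i, by ring⟩)
  · have : (fun i => ((6 * z i : ℤ) : ZMod 3)) = 0 := by
      funext i
      push_cast
      rw [show (6 : ZMod 3) = 0 from rfl, zero_mul]
      rfl
    rw [this]
    exact C.zero_mem
  · obtain ⟨k, hk⟩ := hz
    rw [← Finset.mul_sum, hk]
    exact (Int.modEq_zero_iff_dvd.mpr ⟨3 * k, by ring⟩)

section MinNorm

variable {C : Submodule (ZMod 3) (Fin 48 → ZMod 3)} (hC : IsGoodCode C)
include hC

theorem IsGoodCode.three_dvd_sum_sq {x : Fin 48 → ℤ} (h : (fun i => ((x i : ℤ) : ZMod 3)) ∈ C) :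
    (3 : ℤ) ∣ ∑ i, x i ^ 2 := by
  have := hC.sum_sq _ h
  rw [← Int.cast_ofNat (R := ℤ), Int.cast_id]
  refine (ZMod.intCast_zmod_eq_zero_iff_dvd _ 3).mp ?_
  push_cast
  exact this

/-- The sum of squares is divisible by 3 by self-orthogonality, and even because `y² ≡ y` modulo 2.
Below 18 it is at most 12, and it bounds the weight of `y` modulo 3, which is therefore zero. Then
9, hence 18, divides the sum. -/
theorem IsGoodCode.eq_zero_of_even {y : Fin 48 → ℤ} (h : (fun i => ((y i : ℤ) : ZMod 3)) ∈ C)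
    (h2 : Even (∑ i, y i)) (hlt : ∑ i, y i ^ 2 < 18) : y = 0 := by
  have h3 := hC.three_dvd_sum_sq h
  have h2' : Even (∑ i, y i ^ 2) := by
    have : Even (∑ i, (y i ^ 2 + y i)) := Finset.even_sum _ fun i _ => by
      rw [sq, ← mul_add_one]
      exact Int.even_mul_succ_self _
    rw [Finset.sum_add_distrib] at this
    exact (Int.even_add.mp this).mpr h2
  have h0 : 0 ≤ ∑ i, y i ^ 2 := Finset.sum_nonneg fun i _ => sq_nonneg _
  have hw : (hammingNorm (fun i => ((y i : ℤ) : ZMod 3)) : ℤ) ≤ ∑ i, y i ^ 2 := by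
    rw [hammingNorm, Finset.card_filter, Nat.cast_sum]
    refine Finset.sum_le_sum fun i _ => ?_
    split_ifs with hi
    · have : y i ≠ 0 := by rintro h; rw [h] at hi; exact hi (by simp)
      have := Int.one_le_abs this
      rw [← sq_abs]
      push_cast
      nlinarith
    · push_cast; positivity
  have hz : (fun i => ((y i : ℤ) : ZMod 3)) = 0 := by
    by_contra hne
    have := hC.lt_hammingNorm _ h hne
    rw [even_iff_two_dvd] at h2'
    omega
  have hdvd (i : Fin 48) : (3 : ℤ) ∣ y i := (ZMod.intCast_zmod_eq_zero_iff_dvd _ 3).mp (congrFun hz i)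
  have h9 : (9 : ℤ) ∣ ∑ i, y i ^ 2 := Finset.dvd_sum fun i _ => by
    obtain ⟨k, hk⟩ := hdvd i
    exact ⟨k ^ 2, by rw [hk]; ring⟩
  rw [even_iff_two_dvd] at h2'
  have hs : ∑ i, y i ^ 2 = 0 := by omega
  funext i
  have := (Finset.sum_eq_zero_iff_of_nonneg fun i _ => sq_nonneg (y i)).mp hs i (Finset.mem_univ i)
  simpa using this

/-- Odd squares are 1 modulo 8, so the sum of squares is `48 + 8k` with `3 ∣ k`; below 72 this
forces `k = 0` and all entries `±1`. With an even number `N` of entries `-1` the coordinate sum `48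
- 2N` is 0 modulo 4. -/
theorem IsGoodCode.le_sum_sq_of_odd {x : Fin 48 → ℤ} (h : (fun i => ((x i : ℤ) : ZMod 3)) ∈ C)
    (ho : ∀ i, x i % 2 = 1) (h4 : ∑ i, x i ≡ 2 [ZMOD 4]) : 72 ≤ ∑ i, x i ^ 2 := by
  by_contra! hlt
  have h3 := hC.three_dvd_sum_sq h
  have hsq (i : Fin 48) : ∃ k : ℤ, x i ^ 2 = 1 + 8 * k ∧ 0 ≤ k := by
    obtain ⟨l, hl⟩ : ∃ l, x i = 2 * l + 1 := ⟨x i / 2, by have := ho i; omega⟩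
    obtain ⟨k, hk⟩ := Int.even_mul_succ_self l
    refine ⟨k, by rw [hl]; linear_combination 4 * hk, ?_⟩
    nlinarith [sq_nonneg (2 * l + 1), show x i ^ 2 = 1 + 8 * k by rw [hl]; linear_combination 4 * hk]
  choose k hk hk0 using hsq
  have hs : ∑ i, x i ^ 2 = 48 + 8 * ∑ i, k i := by
    simp only [hk, Finset.sum_add_distrib, ← Finset.mul_sum]
    simp
  have hk0' : 0 ≤ ∑ i, k i := Finset.sum_nonneg fun i _ => hk0 i
  have hks : ∑ i, k i = 0 := by omega
  have hk1 (i : Fin 48) : x i = 1 ∨ x i = -1 := by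
    have := (Finset.sum_eq_zero_iff_of_nonneg fun i _ => hk0 i).mp hks i (Finset.mem_univ i)
    have h1 := hk i
    rw [this] at h1
    exact mul_self_eq_one_iff.mp (by rw [← sq]; simpa using h1)
  have he := hC.even_card _ h fun i => by rcases hk1 i with h | h <;> rw [h] <;> decide
  have hsum : ∑ i, x i = 48 - 2 * (Finset.card {i | ((x i : ℤ) : ZMod 3) = 2} : ℕ) := by
    rw [Finset.card_filter, Nat.cast_sum, Finset.mul_sum]
    have h48 : (48 : ℤ) = ∑ _i : Fin 48, 1 := by simp
    rw [h48, ← Finset.sum_sub_distrib]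
    refine Finset.sum_congr rfl fun i _ => ?_
    rcases hk1 i with h | h <;> rw [h] <;> decide
  obtain ⟨r, hr⟩ := he
  rw [hsum, hr] at h4
  have := h4.dvd
  push_cast at this
  omega

theorem IsGoodCode.hasMinNorm : HasMinNorm (ternaryCodeLattice C) 6 := by
  constructor
  -- The vector with `x = (6, 6, 0, …, 0)` attains `72 / 12 = 6`.
  · let z : Fin 48 → ℤ := fun i => if i = 0 ∨ i = 1 then 1 else 0
    let v : EuclideanSpace ℝ (Fin 48) := WithLp.toLp 2 fun i => (6 * z i : ℝ) / √12
    have hn : ‖v‖ ^ 2 = 6 := by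
      rw [norm_sq_of_eq_div (x := fun i => 6 * z i) fun i => by simp [v]]
      rw [show (∑ i, (6 * z i) ^ 2) = 72 by decide +kernel]
      norm_num
    refine ⟨v, mem_ternaryCodeLattice_of_six (z := z) (fun i => rfl) (by decide +kernel), ?_, hn⟩
    intro h
    rw [h] at hn
    norm_num at hn
  · rintro _ ⟨v, ⟨x, m, hv, hx2, hx3, hx4⟩, hv0, rfl⟩
    rw [norm_sq_of_eq_div hv, le_div_iff₀ (by norm_num)]
    suffices 72 ≤ ∑ i, x i ^ 2 by
      have h' : ((72 : ℤ) : ℝ) ≤ (∑ i, x i ^ 2 : ℤ) := Int.cast_le.mpr this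
      norm_num at h' ⊢
      exact h'
    rcases Int.even_or_odd m with ⟨l, rfl⟩ | ⟨l, rfl⟩
    · by_contra! hlt
      have hx (i : Fin 48) : ∃ y, x i = 2 * y := by
        have := (hx2 i).dvd
        exact ⟨x i / 2, by omega⟩
      choose y hy using hx
      have hy0 : y = 0 := by
        refine hC.eq_zero_of_even ?_ ?_ ?_
        -- Modulo 3, `2` is its own inverse, so `y` is twice the codeword of `x`.
        · have := C.smul_mem 2 hx3
          convert this using 1
          funext i
          simp only [hy, Pi.smul_apply, smul_eq_mul]
          push_cast
          rw [← mul_assoc, show (2 * 2 : ZMod 3) = 1 from rfl, one_mul]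
        · simp only [hy, ← Finset.mul_sum] at hx4
          have := hx4.dvd
          rw [even_iff_two_dvd]
          omega
        · simp only [hy, mul_pow, ← Finset.mul_sum] at hlt
          omega
      apply hv0
      ext i
      rw [hv i, hy i, hy0]
      simp
    · refine hC.le_sum_sq_of_odd hx3 (fun i => ?_) ?_
      · have := (hx2 i).dvd
        omega
      · refine hx4.trans (Int.modEq_iff_dvd.mpr ⟨-l, by ring⟩)

end MinNorm

/-! ### Covolumes and Gram matrices -/

section Gram

open Module ZLattice Matrix

variable {E : Type*} [NormedAddCommGroup E] [InnerProductSpace ℝ E]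

theorem gram_sum_smul {ι κ : Type*} [Fintype κ] (T : Matrix ι κ ℝ) (v : κ → E) :
    gram ℝ (fun i => ∑ k, T i k • v k) = T * gram ℝ v * T.transpose := by
  ext i j
  simp only [gram_apply, sum_inner, inner_sum, real_inner_smul_left, real_inner_smul_right,
    mul_apply, transpose_apply, Finset.sum_mul]
  exact Finset.sum_congr rfl fun _ _ => Finset.sum_congr rfl fun _ _ => by ring

variable [FiniteDimensional ℝ E] [MeasurableSpace E] [BorelSpace E]

/-- If `B` holds the coordinates of the basis in an orthonormal basis, the covolume is `|det B|` and
the Gram matrix is `Bᵀ B`. -/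
theorem covolume_sq_eq_det_gram {ι : Type*} [Fintype ι] [DecidableEq ι] (L : Submodule ℤ E)
    [DiscreteTopology L] [IsZLattice ℝ L] (b : Basis ι ℤ L) :
    covolume L ^ 2 = (gram ℝ fun i => (b i : E)).det := by
  let e : Fin (finrank ℝ E) ≃ ι :=
    Fintype.equivOfCardEq (by rw [Fintype.card_fin, finrank_eq_card_basis (b.ofZLatticeBasis ℝ)])
  let o := (stdOrthonormalBasis ℝ E).reindex e
  have hvol : MeasureTheory.volume.real (ZSpan.fundamentalDomain o.toBasis) = 1 := by
    rw [MeasureTheory.measureReal_congr (ZSpan.fundamentalDomain_ae_parallelepiped _ _),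
      MeasureTheory.measureReal_def, OrthonormalBasis.coe_toBasis,
      OrthonormalBasis.volume_parallelepiped]
    rfl
  have hg : gram ℝ (fun i => (b i : E)) = (o.toBasis.toMatrix ((↑) ∘ b)).transpose *
      o.toBasis.toMatrix ((↑) ∘ b) := by
    ext i j
    simp only [gram_apply, mul_apply, transpose_apply, Basis.toMatrix_apply, Function.comp_apply,
      OrthonormalBasis.coe_toBasis_repr_apply, OrthonormalBasis.repr_apply_apply]
    rw [← o.sum_inner_mul_inner]
    exact Finset.sum_congr rfl fun k _ => by rw [real_inner_comm]
  rw [covolume_eq_det_mul_measureReal L MeasureTheory.volume b o.toBasis, hvol, mul_one, sq_abs,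
    hg, det_mul, det_transpose, Basis.det_apply, sq]

/-- The lattice `Λ ∩ V` in the orthogonal complement `V` of `U`. -/
noncomputable abbrev orthLattice (Λ : Submodule ℤ E) (U : Submodule ℝ E) :
    Submodule ℤ (Uᗮ : Submodule ℝ E) :=
  ZLattice.comap ℝ Λ Uᗮ.subtype

instance (Λ : Submodule ℤ E) [DiscreteTopology Λ] (U : Submodule ℝ E) :
    DiscreteTopology (orthLattice Λ U) :=
  ZLattice.comap_discreteTopology ℝ Λ Uᗮ.subtypeL.continuous Subtype.val_injective

omit [FiniteDimensional ℝ E] [MeasurableSpace E] [BorelSpace E] in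
theorem isZLattice_orthLattice {Λ : Submodule ℤ E} [DiscreteTopology Λ] {U : Submodule ℝ E}
    (h : Submodule.span ℝ ((Λ : Set E) ∩ Uᗮ) = Uᗮ) : IsZLattice ℝ (orthLattice Λ U) := by
  constructor
  apply Submodule.map_injective_of_injective (f := Uᗮ.subtype) Subtype.val_injective
  rw [Submodule.map_span, Submodule.map_top, Submodule.range_subtype]
  conv_rhs => rw [← h]
  congr 1
  ext x
  constructor
  · rintro ⟨y, hy, rfl⟩
    exact ⟨hy, y.2⟩
  · rintro ⟨h1, h2⟩
    exact ⟨⟨x, h2⟩, h1, rfl⟩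

/-- Lifts `w i` of the `b i`, together with a basis of `Λ ∩ V`, form a basis of `Λ`. Removing from
each `w i` its `V`-part, a real combination of the basis of `Λ ∩ V`, is a unipotent change of
vectors, after which the Gram matrix is block diagonal. -/
theorem covolume_sq_eq_mul {Λ : Submodule ℤ E} [DiscreteTopology Λ] [IsZLattice ℝ Λ]
    {U : Submodule ℝ E} [IsZLattice ℝ (orthLattice Λ U)] {ι : Type*} [Fintype ι] [DecidableEq ι]
    (b : Basis ι ℤ (projLattice Λ U)) (hb : (gram ℝ fun i => (b i : U)).det ≠ 0) :
    covolume Λ ^ 2 = (gram ℝ fun i => (b i : U)).det * covolume (orthLattice Λ U) ^ 2 := by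
  classical
  let c := Free.chooseBasis ℤ (orthLattice Λ U)
  have hex (i : ι) : ∃ w ∈ Λ, U.orthogonalProjectionOnto w = (b i : U) := (b i).2
  choose w hwΛ hw using hex
  let l (j : Free.ChooseBasisIndex ℤ (orthLattice Λ U)) : E := ((c j : (Uᗮ : Submodule ℝ E)) : E)
  let v := Sum.elim w l
  let v' := Sum.elim (fun i => ((b i : U) : E)) l
  have horth (i : ι) : w i - ((b i : U) : E) ∈ Uᗮ := by
    rw [← hw i]
    exact U.sub_starProjection_mem_orthogonal (w i)
  let X : Matrix ι (Free.ChooseBasisIndex ℤ (orthLattice Λ U)) ℝ := fun i j =>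
    (c.ofZLatticeBasis ℝ).repr ⟨_, horth i⟩ j
  have hX (i : ι) : w i = ((b i : U) : E) + ∑ j, X i j • l j := by
    have h1 := congrArg (Subtype.val) ((c.ofZLatticeBasis ℝ).sum_repr ⟨_, horth i⟩)
    rw [Submodule.coe_sum] at h1
    simp only [Basis.ofZLatticeBasis_apply, Submodule.coe_smul] at h1
    rw [h1, add_sub_cancel]
  have hv : v = fun i => ∑ k, (fromBlocks (1 : Matrix ι ι ℝ) X 0 1) i k • v' k := by
    funext i
    rw [Fintype.sum_sum_type]
    rcases i with i | j
    · simp only [fromBlocks_apply₁₁, fromBlocks_apply₁₂, one_apply, ite_smul, one_smul, zero_smul,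
        Finset.sum_ite_eq, Finset.mem_univ, if_true]
      exact hX i
    · simp [v, v', one_apply, ite_smul]
  have hblock : gram ℝ v' = fromBlocks (gram ℝ fun i => (b i : U)) 0 0
      (gram ℝ fun j => (c j : (Uᗮ : Submodule ℝ E))) := by
    ext i j
    rcases i with i | i <;> rcases j with j | j
    · rfl
    · exact U.inner_right_of_mem_orthogonal (b i : U).2 (c j : (Uᗮ : Submodule ℝ E)).2
    · exact U.inner_left_of_mem_orthogonal (b j : U).2 (c i : (Uᗮ : Submodule ℝ E)).2
    · rfl
  have hdet : (gram ℝ v).det =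
      (gram ℝ fun i => (b i : U)).det * covolume (orthLattice Λ U) ^ 2 := by
    rw [hv, gram_sum_smul, det_mul, det_mul, det_transpose, det_fromBlocks_zero₂₁, det_one,
      det_one, hblock, det_fromBlocks_zero₂₁, ← covolume_sq_eq_det_gram (orthLattice Λ U) c]
    ring
  have hne : (gram ℝ v).det ≠ 0 := by
    rw [hdet]
    exact mul_ne_zero hb (pow_ne_zero _ (covolume_ne_zero _ _))
  have hvΛ (k : ι ⊕ Free.ChooseBasisIndex ℤ (orthLattice Λ U)) : v k ∈ Λ := by
    rcases k with i | j
    · exact hwΛ i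
    · exact (c j).2
  have hli : LinearIndependent ℤ fun k => (⟨v k, hvΛ k⟩ : Λ) := by
    refine LinearIndependent.of_comp Λ.subtype ?_
    exact (linearIndependent_of_det_gram_ne_zero hne).restrict_scalars' ℤ
  -- Subtracting from `x` the lift of its projection leaves a vector of `Λ ∩ V`.
  have hsp : ⊤ ≤ Submodule.span ℤ (Set.range fun k => (⟨v k, hvΛ k⟩ : Λ)) := by
    rintro ⟨x, hx⟩ -
    have hUx : U.orthogonalProjectionOnto x ∈ projLattice Λ U := ⟨x, hx, rfl⟩
    let a := b.repr ⟨_, hUx⟩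
    have h1 : ((∑ i, a i • b i : projLattice Λ U) : U) = U.orthogonalProjectionOnto x :=
      congrArg Subtype.val (b.sum_repr ⟨_, hUx⟩)
    let y := x - ∑ i, a i • w i
    have hyΛ : y ∈ Λ := sub_mem hx (sum_mem fun i _ => Submodule.smul_mem _ _ (hwΛ i))
    have hyU : y ∈ Uᗮ := by
      rw [← Submodule.orthogonalProjectionOnto_eq_zero_iff, map_sub, map_sum, sub_eq_zero, ← h1]
      simp only [map_zsmul, hw]
      push_cast
      rfl
    let d := c.repr ⟨⟨y, hyU⟩, hyΛ⟩
    have h2 : (((∑ j, d j • c j : orthLattice Λ U) : (Uᗮ : Submodule ℝ E)) : E) = y :=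
      congrArg (fun z : orthLattice Λ U => ((z : (Uᗮ : Submodule ℝ E)) : E))
        (c.sum_repr ⟨⟨y, hyU⟩, hyΛ⟩)
    have h3 : (⟨x, hx⟩ : Λ) = ∑ i, a i • ⟨w i, hwΛ i⟩ + ∑ j, d j • ⟨l j, (c j).2⟩ := by
      apply Subtype.ext
      push_cast at h2 ⊢
      rw [h2, add_sub_cancel]
    rw [h3]
    refine add_mem (sum_mem fun i _ => Submodule.smul_mem _ _ (Submodule.subset_span ⟨Sum.inl i, rfl⟩))
      (sum_mem fun j _ => Submodule.smul_mem _ _ (Submodule.subset_span ⟨Sum.inr j, rfl⟩))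
  rw [covolume_sq_eq_det_gram Λ (Basis.mk hli hsp), ← hdet]
  simp only [Basis.mk_apply]

end Gram

/-! ### The covolume of the code lattice -/

section Index

theorem index_inf_of_coprime {G : Type*} [AddGroup G] {H K : AddSubgroup G}
    (h : Nat.Coprime H.index K.index) (hH : H.index ≠ 0) (hK : K.index ≠ 0) :
    (H ⊓ K).index = H.index * K.index :=
  le_antisymm AddSubgroup.index_inf_le
    (Nat.le_of_dvd (Nat.pos_of_ne_zero (AddSubgroup.index_inf_ne_zero hH hK))
      (h.mul_dvd_of_dvd_of_dvd (AddSubgroup.index_dvd_of_le inf_le_left)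
        (AddSubgroup.index_dvd_of_le inf_le_right)))

/-- Reduction modulo 3. -/
def reduceThree : (Fin 48 → ℤ) →+ (Fin 48 → ZMod 3) where
  toFun x i := (x i : ZMod 3)
  map_zero' := by funext i; simp
  map_add' x y := by funext i; simp

theorem reduceThree_surjective : Function.Surjective reduceThree := fun y =>
  ⟨fun i => (y i).val, by funext i; simp [reduceThree]⟩

/-- The differences to the first coordinate, modulo 2. -/
def differencesTwo : (Fin 48 → ℤ) →+ (Fin 47 → ZMod 2) where
  toFun x i := ((x i.succ - x 0 : ℤ) : ZMod 2)
  map_zero' := by funext i; simp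
  map_add' x y := by funext i; simp; ring

theorem differencesTwo_surjective : Function.Surjective differencesTwo := fun y =>
  ⟨Fin.cons 0 fun i => ((y i).val : ℤ), by funext i; simp [differencesTwo]⟩

/-- The coordinate sum diminished by twice the first coordinate, modulo 4. -/
def sumFour : (Fin 48 → ℤ) →+ ZMod 4 where
  toFun x := ((∑ i, x i - 2 * x 0 : ℤ) : ZMod 4)
  map_zero' := by simp
  map_add' x y := by simp [Finset.sum_add_distrib]; ring

theorem mem_ker_differencesTwo {x : Fin 48 → ℤ} :
    x ∈ differencesTwo.ker ↔ ∀ i, x i ≡ x 0 [ZMOD 2] := by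
  rw [AddMonoidHom.mem_ker]
  constructor
  · intro h i
    refine Fin.cases rfl (fun i => ?_) i
    have := congrFun h i
    exact ((ZMod.intCast_zmod_eq_zero_iff_dvd _ 2).mp this |> (Int.modEq_iff_dvd.mpr ·)).symm
  · intro h
    funext i
    exact (ZMod.intCast_zmod_eq_zero_iff_dvd _ 2).mpr (h i.succ).symm.dvd

theorem index_ker_differencesTwo : differencesTwo.ker.index = 2 ^ 47 := by
  rw [AddSubgroup.index_ker, AddMonoidHom.range_eq_top.mpr differencesTwo_surjective]
  simp

/-- If all coordinates have the parity of `x 0`, the value is even, so the condition modulo 4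
contributes only a factor 2 to the index. -/
theorem card_sumFour_image :
    Nat.card (differencesTwo.ker.map sumFour) = 2 := by
  have : (differencesTwo.ker.map sumFour : Set (ZMod 4)) = ({0, 2} : Finset (ZMod 4)) := by
    ext y
    constructor
    · rintro ⟨x, hx, rfl⟩
      have hx' := mem_ker_differencesTwo.mp hx
      have hk (i : Fin 48) : ∃ k, x i = x 0 + 2 * k := by
        obtain ⟨k, hk⟩ := (hx' i).symm.dvd
        exact ⟨k, by linarith⟩
      choose k hk using hk
      have hs : ∑ i, x i = 48 * x 0 + 2 * ∑ i, k i := by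
        rw [Finset.sum_congr rfl fun i _ => hk i, Finset.sum_add_distrib, ← Finset.mul_sum]
        simp
      have : sumFour x = (2 : ZMod 4) * ((23 * x 0 + ∑ i, k i : ℤ) : ZMod 4) := by
        change ((∑ i, x i - 2 * x 0 : ℤ) : ZMod 4) = _
        rw [hs]
        push_cast
        ring
      rw [this]
      generalize ((23 * x 0 + ∑ i, k i : ℤ) : ZMod 4) = z
      revert z
      decide
    · intro hy
      have hy' : y = 0 ∨ y = 2 := by simpa using hy
      rcases hy' with rfl | rfl
      · exact ⟨0, zero_mem _, map_zero _⟩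
      · refine ⟨Pi.single 1 2, mem_ker_differencesTwo.mpr ?_, ?_⟩
        · decide +kernel
        · decide +kernel
  have h2 : Nat.card (differencesTwo.ker.map sumFour : Set (ZMod 4)) = 2 := by
    rw [this, Nat.card_coe_set_eq, Set.ncard_coe_finset]
    rfl
  exact h2

theorem index_ker_inf_ker : (differencesTwo.ker ⊓ sumFour.ker).index = 2 ^ 48 := by
  rw [← AddSubgroup.relIndex_mul_index (inf_le_left : differencesTwo.ker ⊓ sumFour.ker ≤ _),
    AddSubgroup.inf_relIndex_left, AddSubgroup.relIndex_ker, index_ker_differencesTwo]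
  have := card_sumFour_image
  rw [this]
  norm_num

variable {C : Submodule (ZMod 3) (Fin 48 → ZMod 3)}

/-- The integral vectors `x` with `x / √12` in the code lattice. -/
def codeSubgroup (C : Submodule (ZMod 3) (Fin 48 → ZMod 3)) : AddSubgroup (Fin 48 → ℤ) :=
  C.toAddSubgroup.comap reduceThree ⊓ (differencesTwo.ker ⊓ sumFour.ker)

/-- Only the parity of `m` matters, since `2 * m` is taken modulo 4; hence `x 0` can serve as `m`.
-/
theorem mem_codeSubgroup {x : Fin 48 → ℤ} : x ∈ codeSubgroup C ↔
    ∃ m : ℤ, (∀ i, x i ≡ m [ZMOD 2]) ∧ (fun i => ((x i : ℤ) : ZMod 3)) ∈ C ∧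
      ∑ i, x i ≡ 2 * m [ZMOD 4] := by
  have hker : x ∈ sumFour.ker ↔ ∑ i, x i ≡ 2 * x 0 [ZMOD 4] := by
    rw [AddMonoidHom.mem_ker]
    refine (ZMod.intCast_zmod_eq_zero_iff_dvd _ 4).trans ?_
    rw [Int.modEq_comm, Int.modEq_iff_dvd]
    rfl
  have hmul {m n : ℤ} (h : m ≡ n [ZMOD 2]) : 2 * m ≡ 2 * n [ZMOD 4] := h.mul_left' (c := 2)
  rw [codeSubgroup, AddSubgroup.mem_inf, AddSubgroup.mem_inf, mem_ker_differencesTwo, hker]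
  constructor
  · rintro ⟨h1, h2, h3⟩
    exact ⟨x 0, h2, h1, h3⟩
  · rintro ⟨m, h1, h2, h3⟩
    exact ⟨h2, fun i => (h1 i).trans (h1 0).symm, h3.trans (hmul (h1 0).symm)⟩

/-- The condition modulo 3 has index `3 ^ 24`, those modulo 2 and 4 together have index `2 ^ 48`,
and coprime indices multiply. -/
theorem IsGoodCode.index_codeSubgroup (hC : IsGoodCode C) : (codeSubgroup C).index = 12 ^ 24 := by
  have h3 : (C.toAddSubgroup.comap reduceThree).index = 3 ^ 24 := by
    rw [AddSubgroup.index_comap_of_surjective _ reduceThree_surjective]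
    have h := C.toAddSubgroup.card_mul_index
    have hc : Nat.card C.toAddSubgroup = 3 ^ 24 := hC.card_eq
    rw [hc, Nat.card_pi] at h
    simp only [Nat.card_zmod, Finset.prod_const, Finset.card_univ, Fintype.card_fin] at h
    refine Nat.eq_of_mul_eq_mul_left (show 0 < 3 ^ 24 by positivity) (h.trans ?_)
    norm_num
  rw [codeSubgroup, index_inf_of_coprime, h3, index_ker_inf_ker]
  · norm_num
  · rw [h3, index_ker_inf_ker]
    exact Nat.Coprime.pow _ _ (by norm_num)
  · rw [h3]; norm_num
  · rw [index_ker_inf_ker]; norm_num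

end Index

section Covolume

open Module ZLattice Matrix

/-- The basis of the vectors `eᵢ / √12`. -/
noncomputable def scaledBasis : Basis (Fin 48) ℝ (EuclideanSpace ℝ (Fin 48)) :=
  (EuclideanSpace.basisFun (Fin 48) ℝ).toBasis.isUnitSMul (w := fun _ => 1 / √12)
    fun _ => IsUnit.mk0 _ (by positivity)

theorem scaledBasis_apply (i : Fin 48) :
    scaledBasis i = (1 / √12 : ℝ) • EuclideanSpace.single i (1 : ℝ) := by
  rw [scaledBasis, Basis.isUnitSMul_apply, OrthonormalBasis.coe_toBasis,
    EuclideanSpace.basisFun_apply]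

/-- The map `x ↦ x / √12` on integral vectors. -/
noncomputable def scaledInt : (Fin 48 → ℤ) →+ EuclideanSpace ℝ (Fin 48) where
  toFun x := WithLp.toLp 2 fun i => (x i : ℝ) / √12
  map_zero' := by ext i; simp
  map_add' x y := by ext i; simp [add_div]

theorem scaledInt_apply (x : Fin 48 → ℤ) (i : Fin 48) : scaledInt x i = (x i : ℝ) / √12 := rfl

theorem scaledInt_injective : Function.Injective scaledInt := fun x y h => by
  funext i
  have := congrArg (fun v : EuclideanSpace ℝ (Fin 48) => v i) h
  simp only [scaledInt_apply] at this
  have h12 : √12 ≠ 0 := by positivity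
  exact_mod_cast (div_left_inj' h12).mp this

theorem scaledInt_eq_sum (x : Fin 48 → ℤ) : scaledInt x = ∑ i, x i • scaledBasis i := by
  ext j
  rw [scaledInt_apply, WithLp.ofLp_sum, Finset.sum_apply]
  simp [scaledBasis_apply, div_eq_mul_inv]

/-- The lattice of all `x / √12` with `x` integral. -/
noncomputable abbrev scaledLattice : Submodule ℤ (EuclideanSpace ℝ (Fin 48)) :=
  Submodule.span ℤ (Set.range scaledBasis)

theorem toAddSubgroup_scaledLattice : scaledLattice.toAddSubgroup = (⊤ : AddSubgroup _).map scaledInt := by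
  ext v
  rw [Submodule.mem_toAddSubgroup, Submodule.mem_span_range_iff_exists_fun]
  simp only [AddSubgroup.mem_map, AddSubgroup.mem_top, true_and, scaledInt_eq_sum]

theorem toAddSubgroup_ternaryCodeLattice (C : Submodule (ZMod 3) (Fin 48 → ZMod 3)) :
    (ternaryCodeLattice C).toAddSubgroup = (codeSubgroup C).map scaledInt := by
  ext v
  rw [AddSubgroup.mem_map]
  constructor
  · rintro ⟨x, m, hv, h⟩
    exact ⟨x, mem_codeSubgroup.mpr ⟨m, h⟩, by ext i; rw [hv i]; rfl⟩
  · rintro ⟨x, hx, rfl⟩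
    obtain ⟨m, h⟩ := mem_codeSubgroup.mp hx
    exact ⟨x, m, fun i => rfl, h⟩

theorem ternaryCodeLattice_le (C : Submodule (ZMod 3) (Fin 48 → ZMod 3)) :
    ternaryCodeLattice C ≤ scaledLattice := by
  rw [← Submodule.toAddSubgroup_le, toAddSubgroup_scaledLattice, toAddSubgroup_ternaryCodeLattice]
  exact AddSubgroup.map_mono le_top

instance (C : Submodule (ZMod 3) (Fin 48 → ZMod 3)) : DiscreteTopology (ternaryCodeLattice C) :=
  DiscreteTopology.of_subset (s := (scaledLattice : Set (EuclideanSpace ℝ (Fin 48))))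
    (inferInstance : DiscreteTopology scaledLattice) (ternaryCodeLattice_le C)

instance (C : Submodule (ZMod 3) (Fin 48 → ZMod 3)) : IsZLattice ℝ (ternaryCodeLattice C) := by
  constructor
  rw [eq_top_iff, ← (EuclideanSpace.basisFun (Fin 48) ℝ).toBasis.span_eq, Submodule.span_le]
  rintro _ ⟨i, rfl⟩
  rw [OrthonormalBasis.coe_toBasis, EuclideanSpace.basisFun_apply, SetLike.mem_coe]
  have h12 : √12 ≠ 0 := by positivity
  have hmem : (12 / √12 : ℝ) • EuclideanSpace.single i (1 : ℝ) ∈ ternaryCodeLattice C := by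
    refine mem_ternaryCodeLattice_of_six (z := Pi.single i 2) (fun j => ?_) ?_
    · rcases eq_or_ne j i with rfl | h
      · simp; norm_num
      · simp [h]
    · rw [Finset.sum_pi_single']
      simp
  have := Submodule.smul_mem _ (√12 / 12) (Submodule.subset_span (R := ℝ) hmem)
  rwa [smul_smul, show √12 / 12 * (12 / √12) = 1 by field_simp, one_smul] at this

theorem covolume_scaledLattice_sq : covolume scaledLattice ^ 2 = (1 / 12) ^ 48 := by
  rw [covolume_sq_eq_det_gram scaledLattice (scaledBasis.restrictScalars ℤ)]
  have : (gram ℝ fun i => (scaledBasis.restrictScalars ℤ i : EuclideanSpace ℝ (Fin 48))) =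
      diagonal fun _ => (1 / 12 : ℝ) := by
    ext i j
    rw [gram_apply, Basis.restrictScalars_apply, Basis.restrictScalars_apply, scaledBasis_apply,
      scaledBasis_apply, real_inner_smul_left, real_inner_smul_right,
      EuclideanSpace.inner_single_left, diagonal_apply]
    have h12 : (1 / √12 : ℝ) * (1 / √12) = 1 / 12 := by
      rw [div_mul_div_comm, Real.mul_self_sqrt (by norm_num), one_mul]
    rcases eq_or_ne i j with rfl | h
    · simpa using h12
    · simp [h]
  rw [this, det_diagonal]
  simp

theorem IsGoodCode.covolume_sq {C : Submodule (ZMod 3) (Fin 48 → ZMod 3)} (hC : IsGoodCode C) :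
    covolume (ternaryCodeLattice C) ^ 2 = 1 := by
  have h := covolume_div_covolume_eq_relIndex' (ternaryCodeLattice C) scaledLattice
    (ternaryCodeLattice_le C)
  rw [toAddSubgroup_scaledLattice, toAddSubgroup_ternaryCodeLattice,
    AddSubgroup.relIndex_map_map_of_injective _ _ scaledInt_injective, AddSubgroup.relIndex_top_right,
    hC.index_codeSubgroup, div_eq_iff (covolume_ne_zero _ _)] at h
  rw [h, mul_pow, covolume_scaledLattice_sq]
  norm_num

end Covolume

/-! ### Densities of unions of translates of a lattice -/

section Density

open Module ZLattice MeasureTheory Filter Topology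

variable {E : Type*} [NormedAddCommGroup E] [InnerProductSpace ℝ E] [FiniteDimensional ℝ E]
  (L : Submodule ℤ E) [DiscreteTopology L]

theorem finite_closedBall_inter (R : ℝ) : (Metric.closedBall (0 : E) R ∩ L).Finite := by
  have : DiscreteTopology L.toAddSubgroup := (inferInstance : DiscreteTopology L)
  change (Metric.closedBall (0 : E) R ∩ L.toAddSubgroup).Finite
  exact Metric.finite_isBounded_inter_isClosed DiscreteTopology.isDiscrete
    Metric.isBounded_closedBall inferInstance

/-- The lattice vectors of norm at most `R`. -/
noncomputable def latticeBall (R : ℝ) : Finset E := (finite_closedBall_inter L R).toFinset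

theorem mem_latticeBall {R : ℝ} {x : E} : x ∈ latticeBall L R ↔ ‖x‖ ≤ R ∧ x ∈ L := by
  simp [latticeBall]

variable [MeasurableSpace E] [BorelSpace E] [IsZLattice ℝ L] [Nontrivial E]

/-- Lattice points are counted by a function homogeneous of degree the dimension, here a power of
the norm; substituting the same power of `R` gives the count in balls. -/
theorem tendsto_card_latticeBall_div :
    Tendsto (fun R : ℝ => ((latticeBall L R).card : ℝ) / R ^ finrank ℝ E) atTop
      (𝓝 (volume.real (Metric.ball (0 : E) 1) / covolume L)) := by
  have hl : finrank ℝ E ≠ 0 := finrank_pos.ne'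
  have hset : {x ∈ (Set.univ : Set E) | ‖x‖ ^ finrank ℝ E ≤ 1} = Metric.closedBall 0 1 := by
    ext x
    simp [pow_le_one_iff_of_nonneg (norm_nonneg x) hl]
  have h := covolume.tendsto_card_le_div' L (X := Set.univ) (F := fun x : E => ‖x‖ ^ finrank ℝ E)
    (fun _ _ _ _ => Set.mem_univ _) (fun x r hr => by
      rw [norm_smul, mul_pow, Real.norm_of_nonneg hr])
    (hset ▸ Metric.isBounded_closedBall) (hset ▸ measurableSet_closedBall) (by
      rw [hset, frontier_closedBall _ one_ne_zero]
      exact Measure.addHaar_sphere _ _ _)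
  rw [hset, measureReal_def, Measure.addHaar_unitClosedBall_eq_addHaar_unitBall,
    ← measureReal_def] at h
  refine (h.comp (tendsto_pow_atTop hl)).congr' ?_
  filter_upwards [eventually_ge_atTop 0] with R hR
  simp only [Function.comp_apply]
  congr 2
  rw [latticeBall, ← Set.ncard_eq_toFinset_card _ (finite_closedBall_inter L R), ← Nat.card_coe_set_eq]
  congr 2
  ext x
  simp [pow_le_pow_iff_left₀ (norm_nonneg x) hR hl]

theorem tendsto_card_latticeBall_add_div (D : ℝ) :
    Tendsto (fun R : ℝ => ((latticeBall L (R + D)).card : ℝ) / R ^ finrank ℝ E) atTop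
      (𝓝 (volume.real (Metric.ball (0 : E) 1) / covolume L)) := by
  have h1 := (tendsto_card_latticeBall_div L).comp (tendsto_atTop_add_const_right atTop D tendsto_id)
  have h2 : Tendsto (fun R : ℝ => (1 + D / R) ^ finrank ℝ E) atTop (𝓝 1) := by
    have := ((tendsto_const_nhds (x := D)).div_atTop tendsto_id).const_add (1 : ℝ)
    simpa using this.pow (finrank ℝ E)
  have h3 := h1.mul h2
  rw [mul_one] at h3
  refine h3.congr' ?_
  filter_upwards [eventually_gt_atTop 0, eventually_gt_atTop (-D)] with R hR hD
  have hRD : R + D ≠ 0 := by linarith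
  simp only [Function.comp_apply, id]
  rw [show 1 + D / R = (R + D) / R by field_simp, div_pow]
  field_simp

-- Let `D` bound all `‖t i‖ + ρ`. Lattice vectors of norm at most `R - D` give balls inside the ball
-- of radius `R`, and all balls that meet it come from lattice vectors of norm at most `R + D`. Both
-- counts have the same asymptotics.
variable {L} in
theorem hasCenterDensity_of_translates {A : Set E} {ρ : ℝ} (hA : IsSpherePacking A ρ)
    {ι : Type*} [Fintype ι] (t : ι → E) (ht : ∀ i j, t i - t j ∈ L → i = j)
    (hAt : ∀ x, x ∈ A ↔ ∃ i, x - t i ∈ L) :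
    HasCenterDensity A ρ (Fintype.card ι * ρ ^ finrank ℝ E / covolume L) := by
  classical
  obtain ⟨hρ, hdisj⟩ := hA
  set l := finrank ℝ E
  set β := volume.real (Metric.ball (0 : E) 1)
  have hβ : 0 < β := ENNReal.toReal_pos (Metric.measure_ball_pos _ _ one_pos).ne' measure_ball_lt_top.ne
  have hball (x : E) {r : ℝ} (hr : 0 < r) : volume.real (Metric.ball x r) = r ^ l * β := by
    rw [measureReal_def, Measure.addHaar_ball_of_pos _ _ hr, ENNReal.toReal_mul,
      ENNReal.toReal_ofReal (by positivity)]
    rfl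
  obtain ⟨D₀, hD₀⟩ : ∃ D₀, ∀ i, ‖t i‖ ≤ D₀ :=
    ⟨∑ i, ‖t i‖, fun i => Finset.single_le_sum (f := fun i => ‖t i‖)
      (fun j _ => norm_nonneg _) (Finset.mem_univ i)⟩
  let D := D₀ + ρ
  let f (p : ι × E) : Set E := Metric.ball (t p.1 + p.2) ρ
  have hsum (R : ℝ) : ∑ p ∈ Finset.univ ×ˢ latticeBall L R, volume.real (f p) =
      Fintype.card ι * (latticeBall L R).card * (ρ ^ l * β) := by
    simp [f, hball _ hρ, Finset.card_product]
  have hmemA {p : ι × E} {R : ℝ} (hp : p ∈ Finset.univ ×ˢ latticeBall L R) : t p.1 + p.2 ∈ A :=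
    (hAt _).mpr ⟨p.1, by
      rw [add_sub_cancel_left]
      exact ((mem_latticeBall L).mp (Finset.mem_product.mp hp).2).2⟩
  have lower (R : ℝ) : Fintype.card ι * (latticeBall L (R + -D)).card * (ρ ^ l * β) ≤
      volume.real (Metric.ball (0 : E) R ∩ ⋃ a ∈ A, Metric.ball a ρ) := by
    rw [← hsum, ← measureReal_biUnion_finset]
    · refine measureReal_mono (Set.iUnion₂_subset fun p hp => Set.subset_inter ?_ ?_)
        (measure_ne_top_of_subset Set.inter_subset_left measure_ball_lt_top.ne)
      · have hp2 := ((mem_latticeBall L).mp (Finset.mem_product.mp hp).2).1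
        refine Metric.ball_subset_ball' ?_
        rw [dist_zero_right]
        have := norm_add_le (t p.1) p.2
        have := hD₀ p.1
        simp only [D] at hp2
        linarith
      · exact Set.subset_biUnion_of_mem (u := fun a => Metric.ball a ρ) (hmemA hp)
    · intro p hp q hq hpq
      refine hdisj (hmemA hp) (hmemA hq) fun h => hpq ?_
      have hp2 := ((mem_latticeBall L).mp (Finset.mem_product.mp hp).2).2
      have hq2 := ((mem_latticeBall L).mp (Finset.mem_product.mp hq).2).2
      have h1 : p.1 = q.1 := ht _ _ (by
        have : t p.1 - t q.1 = q.2 - p.2 := by rw [sub_eq_sub_iff_add_eq_add, h, add_comm]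
        rw [this]
        exact sub_mem hq2 hp2)
      refine Prod.ext h1 ?_
      rw [h1] at h
      exact add_left_cancel h
    · exact fun _ _ => measurableSet_ball
  have upper (R : ℝ) : volume.real (Metric.ball (0 : E) R ∩ ⋃ a ∈ A, Metric.ball a ρ) ≤
      Fintype.card ι * (latticeBall L (R + D)).card * (ρ ^ l * β) := by
    rw [← hsum]
    refine le_trans (measureReal_mono ?_ ?_) (measureReal_biUnion_finset_le _ f)
    · rintro x ⟨hx, hxA⟩
      obtain ⟨a, ha, hxa⟩ := Set.mem_iUnion₂.mp hxA
      obtain ⟨i, hi⟩ := (hAt a).mp ha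
      refine Set.mem_iUnion₂.mpr ⟨(i, a - t i), Finset.mem_product.mpr ⟨Finset.mem_univ _,
        (mem_latticeBall L).mpr ⟨?_, hi⟩⟩, ?_⟩
      · have h1 := norm_sub_le a (t i)
        have h2 := hD₀ i
        have h3 : ‖a‖ ≤ ‖x‖ + ρ := by
          have := norm_le_norm_add_norm_sub' a x
          rw [mem_ball_iff_norm'] at hxa
          linarith
        rw [mem_ball_zero_iff] at hx
        simp only [D]
        linarith
      · simpa [f] using hxa
    · exact ((measure_biUnion_finset_le _ _).trans_lt
        (ENNReal.sum_lt_top.mpr fun _ _ => measure_ball_lt_top)).ne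
  have key (D : ℝ) : Tendsto (fun R : ℝ =>
      Fintype.card ι * (latticeBall L (R + D)).card * (ρ ^ l * β) /
        volume.real (Metric.ball (0 : E) R)) atTop
      (𝓝 (Fintype.card ι * ρ ^ l / covolume L * β)) := by
    have := (tendsto_card_latticeBall_add_div L D).const_mul (Fintype.card ι * ρ ^ l : ℝ)
    have he : (Fintype.card ι * ρ ^ l : ℝ) * (β / covolume L) =
        Fintype.card ι * ρ ^ l / covolume L * β := by ring
    rw [he] at this
    refine this.congr' ?_
    filter_upwards [eventually_gt_atTop 0] with R hR
    rw [hball _ hR]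
    simp only [l]
    field_simp
  refine tendsto_of_tendsto_of_tendsto_of_le_of_le (key (-D)) (key D) (fun R => ?_) fun R => ?_
  · exact div_le_div_of_nonneg_right (lower R) measureReal_nonneg
  · exact div_le_div_of_nonneg_right (upper R) measureReal_nonneg

end Density

/-! ### The packings of the antipode construction -/

section Antipode

open Module ZLattice Matrix

theorem LatticeIsometric.inner_eq {E F : Type*} [NormedAddCommGroup E] [InnerProductSpace ℝ E]
    [NormedAddCommGroup F] [InnerProductSpace ℝ F] {M : Submodule ℤ E} {N : Submodule ℤ F}
    {f : M ≃ₗ[ℤ] N} (hf : ∀ x : M, ‖(f x : F)‖ = ‖(x : E)‖) (x y : M) :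
    inner ℝ (f x : F) (f y : F) = inner ℝ (x : E) (y : E) := by
  rw [real_inner_eq_norm_add_mul_self_sub_norm_mul_self_sub_norm_mul_self_div_two,
    real_inner_eq_norm_add_mul_self_sub_norm_mul_self_sub_norm_mul_self_div_two, hf x, hf y,
    ← Submodule.coe_add, ← map_add, hf, Submodule.coe_add]

theorem eq_zero_of_norm_sq_lt {E : Type*} [NormedAddCommGroup E] {Λ : Submodule ℤ E} {μ : ℝ}
    (hμ : HasMinNorm Λ μ) {x : E} (hx : x ∈ Λ) (h : ‖x‖ ^ 2 < μ) : x = 0 := by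
  by_contra hne
  exact h.not_ge (hμ.2 ⟨x, hx, hne, rfl⟩)

variable {E : Type*} [NormedAddCommGroup E] [InnerProductSpace ℝ E] [FiniteDimensional ℝ E]
  {Λ : Submodule ℤ E} {U : Submodule ℝ E} {μ β : ℝ} {s : ℕ} {S : Finset U}

theorem norm_sq_projections (U : Submodule ℝ E) (x : E) : ‖x‖ ^ 2 =
    ‖U.orthogonalProjectionOnto x‖ ^ 2 + ‖Uᗮ.orthogonalProjectionOnto x‖ ^ 2 :=
  U.norm_sq_eq_add_norm_sq_projection x

theorem isSpherePacking_antipode (hμ : HasMinNorm Λ μ) (hβ : β < μ)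
    (hS : IsCloseSubset Λ U s β S) : IsSpherePacking (antipode Λ U S) (1 / 2 * √(μ - β)) := by
  have hpos : 0 < μ - β := sub_pos.mpr hβ
  refine ⟨by positivity, ?_⟩
  rintro _ ⟨w, hw, hwS, rfl⟩ _ ⟨w', hw', hwS', rfl⟩ hne
  refine Metric.ball_disjoint_ball ?_
  rw [← add_mul, add_halves, one_mul]
  refine Real.sqrt_le_iff.mpr ⟨dist_nonneg, ?_⟩
  have h1 : μ ≤ ‖w - w'‖ ^ 2 := hμ.2 ⟨_, sub_mem hw hw', fun h => hne (by rw [sub_eq_zero.mp h]), rfl⟩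
  have h2 := hS.2.2 _ hwS _ hwS'
  rw [norm_sq_projections U, map_sub, map_sub] at h1
  rw [dist_eq_norm] at h2 ⊢
  linarith

theorem orthogonalProjectionOnto_coe_orthogonal (v : (Uᗮ : Submodule ℝ E)) :
    U.orthogonalProjectionOnto (v : E) = 0 :=
  Submodule.orthogonalProjectionOnto_apply_of_mem_orthogonal v.2

theorem exists_isCloseSubset {F : Type*} [NormedAddCommGroup F] {N : Submodule ℤ F}
    (h : LatticeIsometric (projLattice Λ U) N) {p : Fin s → F}
    (hp : ∀ i, p i ∈ N) (hinj : Function.Injective p) (hd : ∀ i j, ‖p i - p j‖ ^ 2 ≤ β) :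
    ∃ S : Finset U, IsCloseSubset Λ U s β S := by
  obtain ⟨f, hf⟩ := h
  let q (i : Fin s) : projLattice Λ U := f.symm ⟨p i, hp i⟩
  have hq : Function.Injective fun i => (q i : U) := fun i j hij =>
    hinj (congrArg Subtype.val (f.symm.injective (Subtype.ext hij)))
  refine ⟨Finset.univ.map ⟨_, hq⟩, fun u hu => ?_, by simp, fun u hu v hv => ?_⟩
  · obtain ⟨i, -, rfl⟩ := Finset.mem_map.mp hu
    exact (q i).2
  · obtain ⟨i, -, rfl⟩ := Finset.mem_map.mp hu
    obtain ⟨j, -, rfl⟩ := Finset.mem_map.mp hv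
    refine le_of_eq_of_le ?_ (hd i j)
    rw [dist_eq_norm]
    change ‖(q i : U) - (q j : U)‖ ^ 2 = _
    rw [← Submodule.coe_sub, ← hf, map_sub]
    simp [q]

variable [MeasurableSpace E] [BorelSpace E] [DiscreteTopology Λ] [IsZLattice ℝ Λ]

omit [IsZLattice ℝ Λ] in
theorem hasCenterDensity_antipode (hμ : HasMinNorm Λ μ) (hβ : β < μ)
    (hS : IsCloseSubset Λ U s β S) [Nontrivial (Uᗮ : Submodule ℝ E)]
    [IsZLattice ℝ (orthLattice Λ U)] :
    HasCenterDensity (antipode Λ U S) (1 / 2 * √(μ - β))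
      (s * (1 / 2 * √(μ - β)) ^ finrank ℝ (Uᗮ : Submodule ℝ E) / covolume (orthLattice Λ U)) := by
  have hex (u : S) : ∃ w ∈ Λ, U.orthogonalProjectionOnto w = u := hS.1 u u.2
  choose w hwΛ hw using hex
  have h := hasCenterDensity_of_translates (L := orthLattice Λ U)
    (isSpherePacking_antipode hμ hβ hS) (fun u : S => Uᗮ.orthogonalProjectionOnto (w u)) ?_ ?_
  · rwa [Fintype.card_coe, hS.2.1] at h
  · intro u u' huu
    let v := Uᗮ.orthogonalProjectionOnto (w u) - Uᗮ.orthogonalProjectionOnto (w u')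
    -- The `V`-part of this vector of `Λ` is zero and its `U`-part is `u - u'`, so its squared norm
    -- is at most `β < μ`.
    have hz : w u - w u' - v = 0 := by
      refine eq_zero_of_norm_sq_lt hμ (sub_mem (sub_mem (hwΛ u) (hwΛ u')) huu)
        (lt_of_le_of_lt ?_ hβ)
      rw [norm_sq_projections U]
      simp only [map_sub, hw, orthogonalProjectionOnto_coe_orthogonal,
        Submodule.orthogonalProjectionOnto_mem_subspace_eq_self, v, sub_zero, sub_self, norm_zero]
      have := hS.2.2 u u.2 u' u'.2
      rw [dist_eq_norm] at this
      simpa using this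
    have := congrArg U.orthogonalProjectionOnto hz
    simp only [map_sub, hw, orthogonalProjectionOnto_coe_orthogonal, sub_zero, map_zero,
      sub_eq_zero] at this
    exact Subtype.ext this
  · intro x
    constructor
    · rintro ⟨y, hy, hyS, rfl⟩
      refine ⟨⟨_, hyS⟩, ?_⟩
      have hmem : y - w ⟨_, hyS⟩ ∈ Uᗮ := by
        rw [← Submodule.orthogonalProjectionOnto_eq_zero_iff, map_sub, hw, sub_self]
      rw [← map_sub]
      change ((Uᗮ.orthogonalProjectionOnto (y - w ⟨_, hyS⟩) : (Uᗮ : Submodule ℝ E)) : E) ∈ Λ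
      rw [Submodule.coe_orthogonalProjectionOnto_apply, Submodule.starProjection_eq_self_iff.mpr hmem]
      exact sub_mem hy (hwΛ _)
    · rintro ⟨u, hu⟩
      refine ⟨w u + (x - Uᗮ.orthogonalProjectionOnto (w u) : (Uᗮ : Submodule ℝ E)),
        add_mem (hwΛ u) hu, ?_, ?_⟩
      · rw [map_add, hw, orthogonalProjectionOnto_coe_orthogonal, add_zero]
        exact u.2
      · rw [map_add, Submodule.orthogonalProjectionOnto_mem_subspace_eq_self, add_sub_cancel]

variable {F : Type*} [NormedAddCommGroup F] [InnerProductSpace ℝ F] {N : Submodule ℤ F}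

/-- An isometry preserves inner products, so every admissible `U` has projected lattice of Gram
determinant `γ`. As `Λ` has covolume 1, `covol(Λ ∩ V) = 1 / √γ`. -/
theorem antipodeConstructionGives_of_basis {k l : ℕ} {δ : ℝ} (hμ : HasMinNorm Λ μ) (hβ : β < μ)
    (hvol : covolume Λ ^ 2 = 1) {ι : Type*} [Fintype ι] [DecidableEq ι] (b : Basis ι ℤ N)
    {γ : ℝ} (hγ : 0 < γ) (hb : (gram ℝ fun i => (b i : F)).det = γ) {p : Fin s → F}
    (hp : ∀ i, p i ∈ N) (hinj : Function.Injective p) (hd : ∀ i j, ‖p i - p j‖ ^ 2 ≤ β)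
    (hl : 0 < l) (hδ : δ = s * (1 / 2 * √(μ - β)) ^ l * √γ)
    (hU : ∃ U : Submodule ℝ E, finrank ℝ U = k ∧ finrank ℝ (Uᗮ : Submodule ℝ E) = l ∧
      SplitsAlong Λ U ∧ LatticeIsometric (projLattice Λ U) N) :
    AntipodeConstructionGives Λ μ k l N s β δ := by
  refine ⟨hμ, hU, fun U _ hUl hUs hUN => ⟨exists_isCloseSubset hUN hp hinj hd, fun S hS =>
    ⟨isSpherePacking_antipode hμ hβ hS, ?_⟩⟩⟩
  have : Nontrivial (Uᗮ : Submodule ℝ E) := nontrivial_of_finrank_pos (hUl ▸ hl)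
  have := isZLattice_orthLattice hUs.2
  obtain ⟨f, hf⟩ := hUN
  have hg : (gram ℝ fun i => (b.map f.symm i : U)) = gram ℝ fun i => (b i : F) := by
    ext i j
    rw [gram_apply, gram_apply, ← LatticeIsometric.inner_eq hf]
    simp
  have hc := covolume_sq_eq_mul (b.map f.symm) (by rw [hg, hb]; exact hγ.ne')
  rw [hg, hb, hvol] at hc
  have hpos := covolume_pos (orthLattice Λ U)
  have hc' : √γ = 1 / covolume (orthLattice Λ U) := by
    rw [Real.sqrt_eq_iff_mul_self_eq hγ.le (by positivity)]
    field_simp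
    linarith
  have h := hasCenterDensity_antipode hμ hβ hS
  rwa [hUl, div_eq_mul_one_div (s * _ : ℝ), ← hc', ← hδ] at h

end Antipode

/-! ### Subspaces spanned by root lattices -/

section Coordinates

open Module

variable {r : ℕ} (g : Fin r → Fin 48)

/-- Extension by zero of vectors to the coordinates outside the range of `g`. -/
noncomputable def extendCoord : EuclideanSpace ℝ (Fin r) →ₗ[ℝ] EuclideanSpace ℝ (Fin 48) where
  toFun a := ∑ i, a i • EuclideanSpace.single (g i) (1 : ℝ)
  map_add' a b := by simp [add_smul, Finset.sum_add_distrib]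
  map_smul' c a := by simp [mul_smul, Finset.smul_sum]

/-- Restriction of vectors to the coordinates in the range of `g`. -/
noncomputable def restrictCoord : EuclideanSpace ℝ (Fin 48) →ₗ[ℝ] EuclideanSpace ℝ (Fin r) where
  toFun v := WithLp.toLp 2 fun i => v (g i)
  map_add' a b := by ext i; simp
  map_smul' c a := by ext i; simp

theorem restrictCoord_apply (v : EuclideanSpace ℝ (Fin 48)) (i : Fin r) :
    restrictCoord g v i = v (g i) := rfl

theorem inner_extendCoord_left (a : EuclideanSpace ℝ (Fin r)) (v : EuclideanSpace ℝ (Fin 48)) :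
    inner ℝ (extendCoord g a) v = inner ℝ a (restrictCoord g v) := by
  change inner ℝ (∑ i, a i • EuclideanSpace.single (g i) (1 : ℝ)) v = _
  simp [sum_inner, PiLp.inner_apply,
    restrictCoord_apply, mul_comm]

variable {g} (hg : Function.Injective g)
include hg

theorem extendCoord_apply_of_injective (a : EuclideanSpace ℝ (Fin r)) (i : Fin r) :
    extendCoord g a (g i) = a i := by
  change (∑ k, a k • EuclideanSpace.single (g k) (1 : ℝ)) (g i) = _
  simp [WithLp.ofLp_sum, Finset.sum_apply, Pi.single_apply, hg.eq_iff]

omit hg in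
theorem extendCoord_apply_of_notMem (a : EuclideanSpace ℝ (Fin r)) {j : Fin 48}
    (hj : j ∉ Set.range g) : extendCoord g a j = 0 := by
  change (∑ k, a k • EuclideanSpace.single (g k) (1 : ℝ)) j = _
  rw [WithLp.ofLp_sum, Finset.sum_apply]
  refine Finset.sum_eq_zero fun i _ => ?_
  have : j ≠ g i := fun h => hj ⟨i, h.symm⟩
  simp [this]

theorem restrictCoord_extendCoord (a : EuclideanSpace ℝ (Fin r)) :
    restrictCoord g (extendCoord g a) = a := by
  ext i
  rw [restrictCoord_apply, extendCoord_apply_of_injective hg]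

theorem norm_extendCoord (a : EuclideanSpace ℝ (Fin r)) : ‖extendCoord g a‖ = ‖a‖ := by
  rw [← sq_eq_sq₀ (norm_nonneg _) (norm_nonneg _), ← real_inner_self_eq_norm_sq,
    ← real_inner_self_eq_norm_sq, inner_extendCoord_left, restrictCoord_extendCoord hg]

theorem extendCoord_injective : Function.Injective (extendCoord g) :=
  Function.LeftInverse.injective (restrictCoord_extendCoord hg)

theorem starProjection_map_extendCoord (W : Submodule ℝ (EuclideanSpace ℝ (Fin r)))
    (w : EuclideanSpace ℝ (Fin 48)) : (W.map (extendCoord g)).starProjection w =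
      extendCoord g (W.starProjection (restrictCoord g w)) := by
  refine Submodule.eq_starProjection_of_mem_orthogonal
    (Submodule.mem_map_of_mem (W.starProjection_apply_mem _)) ?_
  rw [Submodule.mem_orthogonal]
  rintro _ ⟨a, ha, rfl⟩
  rw [inner_extendCoord_left, map_sub, restrictCoord_extendCoord hg]
  exact W.sub_starProjection_mem_orthogonal _ a ha

/-- Restriction of coordinates is isometric on the embedded subspace, so the projected lattice can
be computed in `ℝ^r`. -/
theorem latticeIsometric_projLattice {Λ : Submodule ℤ (EuclideanSpace ℝ (Fin 48))}
    {W : Submodule ℝ (EuclideanSpace ℝ (Fin r))} {N : Submodule ℤ (EuclideanSpace ℝ (Fin r))}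
    (hN : ∀ v, v ∈ N ↔ ∃ w ∈ Λ, W.starProjection (restrictCoord g w) = v) :
    LatticeIsometric (projLattice Λ (W.map (extendCoord g))) N := by
  let U := W.map (extendCoord g)
  let T : U →ₗ[ℤ] EuclideanSpace ℝ (Fin r) :=
    ((restrictCoord g).comp U.subtype).restrictScalars ℤ
  have hT (u : U) : ‖T u‖ = ‖u‖ := by
    obtain ⟨a, ha, hau⟩ := u.2
    change ‖restrictCoord g (u : EuclideanSpace ℝ (Fin 48))‖ =
      ‖(u : EuclideanSpace ℝ (Fin 48))‖
    rw [← hau, restrictCoord_extendCoord hg, norm_extendCoord hg]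
  have hinj : Function.Injective T := by
    refine (injective_iff_map_eq_zero T).mpr fun u hu => ?_
    rw [← norm_eq_zero, ← hT, hu, norm_zero]
  have hproj (w : EuclideanSpace ℝ (Fin 48)) :
      T (U.orthogonalProjectionOnto w) = W.starProjection (restrictCoord g w) := by
    exact (congrArg (restrictCoord g) (starProjection_map_extendCoord hg W w)).trans
      (restrictCoord_extendCoord hg _)
  have hmap : (projLattice Λ U).map T = N := by
    ext v
    rw [hN]
    constructor
    · rintro ⟨_, ⟨w, hw, rfl⟩, rfl⟩
      exact ⟨w, hw, (hproj w).symm⟩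
    · rintro ⟨w, hw, rfl⟩
      exact ⟨_, ⟨w, hw, rfl⟩, hproj w⟩
  refine ⟨((projLattice Λ U).equivMapOfInjective T hinj).trans (LinearEquiv.ofEq _ _ hmap),
    fun x => ?_⟩
  simpa using hT x

end Coordinates

section Roots

open Module

variable {C : Submodule (ZMod 3) (Fin 48 → ZMod 3)} {r : ℕ} {g : Fin r → Fin 48}

theorem sqrt_twelve : √12 = 2 * √3 := by
  rw [show (12 : ℝ) = 2 ^ 2 * 3 by norm_num, Real.sqrt_mul (by norm_num),
    Real.sqrt_sq (by norm_num)]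

theorem sqrt_three_mul_eq (x : ℝ) : √3 * x = 6 * x / √12 := by
  rw [sqrt_twelve, eq_div_iff (by positivity)]
  linear_combination 2 * x * Real.mul_self_sqrt (show (0 : ℝ) ≤ 3 by norm_num)

/-- The code imposes nothing on the chosen coordinates, and the condition modulo 4 can be repaired
at a coordinate outside them. -/
theorem exists_mem_ternaryCodeLattice (hr : r < 48)
    (hC : ∀ x : Fin r → ZMod 3, ∃ c ∈ C, ∀ i, c (g i) = x i) (hg : Function.Injective g)
    (y : Fin r → ℤ) (m : ℤ) (hy : ∀ i, y i ≡ m [ZMOD 2]) :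
    ∃ w ∈ ternaryCodeLattice C, ∀ i, w (g i) = (y i : ℝ) / √12 := by
  obtain ⟨c, hc, hcy⟩ := hC fun i => (y i : ZMod 3)
  -- `4c + 3m` is `c` modulo 3 and `m` modulo 2.
  let x₀ : Fin 48 → ℤ := Function.extend g y fun j => 4 * (c j).val + 3 * m
  have hx₀g (i : Fin r) : x₀ (g i) = y i := hg.extend_apply _ _ _
  have hx₀ (j : Fin 48) (hj : ¬ ∃ i, g i = j) : x₀ j = 4 * (c j).val + 3 * m :=
    Function.extend_apply' _ _ _ hj
  have h2 (j : Fin 48) : x₀ j ≡ m [ZMOD 2] := by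
    by_cases hj : ∃ i, g i = j
    · obtain ⟨i, rfl⟩ := hj
      rw [hx₀g]
      exact hy i
    · rw [hx₀ j hj]
      exact Int.modEq_iff_dvd.mpr ⟨-(2 * (c j).val + m), by ring⟩
  have h3 (j : Fin 48) : (x₀ j : ZMod 3) = c j := by
    by_cases hj : ∃ i, g i = j
    · obtain ⟨i, rfl⟩ := hj
      rw [hx₀g, hcy]
    · rw [hx₀ j hj]
      push_cast
      rw [ZMod.natCast_zmod_val, show (4 : ZMod 3) = 1 from rfl, show (3 : ZMod 3) = 0 from rfl]
      ring
  obtain ⟨j, hj⟩ : ∃ j, ¬ ∃ i, g i = j := by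
    by_contra! h
    have := Fintype.card_le_of_surjective g h
    simp only [Fintype.card_fin] at this
    omega
  obtain ⟨q, hq⟩ : ∃ q, ∑ i, x₀ i = 2 * q := by
    have hk (i : Fin 48) : ∃ k, x₀ i = m + 2 * k := by
      obtain ⟨k, hk⟩ := (h2 i).symm.dvd
      exact ⟨k, by linarith⟩
    choose k hk using hk
    refine ⟨24 * m + ∑ i, k i, ?_⟩
    rw [Finset.sum_congr rfl fun i _ => hk i, Finset.sum_add_distrib, ← Finset.mul_sum]
    simp
    ring
  -- A multiple of 6 preserves the residues modulo 2 and 3; the sum becomes `6m - 4q`, which is `2m`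
  -- modulo 4.
  let x : Fin 48 → ℤ := x₀ + Pi.single j (6 * (m - q))
  refine ⟨WithLp.toLp 2 fun i => (x i : ℝ) / √12, ⟨x, m, fun i => rfl, fun i => ?_, ?_, ?_⟩,
    fun i => ?_⟩
  · have : x i ≡ x₀ i [ZMOD 2] := by
      rcases eq_or_ne i j with rfl | hij
      · exact Int.modEq_iff_dvd.mpr ⟨-(3 * (m - q)), by simp [x]; ring⟩
      · simp [x, hij]
    exact this.trans (h2 i)
  · convert hc using 1
    funext i
    rw [← h3]
    rcases eq_or_ne i j with rfl | hij
    · simp only [x, Pi.add_apply, Pi.single_eq_same]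
      push_cast
      rw [show (6 : ZMod 3) = 0 from rfl]
      ring
    · simp [x, hij]
  · have : ∑ i, x i = 2 * q + 6 * (m - q) := by
      simp only [x, Pi.add_apply, Finset.sum_add_distrib, hq, Finset.sum_pi_single', Finset.mem_univ,
        if_true]
    rw [this]
    exact Int.modEq_iff_dvd.mpr ⟨-(m - q), by ring⟩
  · have hij : g i ≠ j := fun h => hj ⟨i, h⟩
    simp [x, hij, hx₀g]

variable {R : Submodule ℤ (EuclideanSpace ℝ (Fin r))}

theorem sqrt_three_smul_extendCoord_mem (hg : Function.Injective g) {a : EuclideanSpace ℝ (Fin r)}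
    (ha : a ∈ rootD r) : √3 • extendCoord g a ∈ ternaryCodeLattice C := by
  obtain ⟨ha, q, hq⟩ := ha
  choose z hz using ha
  refine mem_ternaryCodeLattice_of_six (z := Function.extend g z 0) (fun j => ?_) ?_
  · rw [PiLp.smul_apply, smul_eq_mul, sqrt_three_mul_eq]
    by_cases hj : j ∈ Set.range g
    · obtain ⟨i, rfl⟩ := hj
      rw [extendCoord_apply_of_injective hg, hg.extend_apply, hz]
    · rw [extendCoord_apply_of_notMem a hj, Function.extend_apply' _ _ _ hj]
      simp
  · have : ∑ j, Function.extend g z 0 j = ∑ i, z i := by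
      rw [← Finset.sum_subset (Finset.subset_univ (Finset.univ.map ⟨g, hg⟩))]
      · rw [Finset.sum_map]
        exact Finset.sum_congr rfl fun i _ => hg.extend_apply _ _ _
      · intro j _ hj
        exact Function.extend_apply' _ _ _ (by simpa using hj)
    rw [this]
    have hq' : ((∑ i, z i : ℤ) : ℝ) = (2 * q : ℤ) := by
      push_cast
      rw [← hq]
      exact Finset.sum_congr rfl fun i _ => (hz i).symm
    rw [Int.cast_inj.mp hq']
    exact even_two_mul q

/-- `√3 R` lies in `Λ ∩ U` and spans `U`. The complement is spanned by the unit vectors at the other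
coordinates and the vectors orthogonal to `R` inside `ℝ^r`, which by `horth` are multiples of
integral ones; doubling makes coordinate sums even. -/
theorem splitsAlong_map_extendCoord (hg : Function.Injective g) (hR : R ≤ rootD r)
    (horth : ∀ a, (∀ x ∈ R, inner ℝ x a = 0) →
      ∃ (c : ℝ) (z : EuclideanSpace ℝ (Fin r)), (∀ i, ∃ m : ℤ, z i = m) ∧
        (∀ x ∈ R, inner ℝ x z = 0) ∧ a = c • z) :
    SplitsAlong (ternaryCodeLattice C)
      ((Submodule.span ℝ (R : Set (EuclideanSpace ℝ (Fin r)))).map (extendCoord g)) := by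
  set W := Submodule.span ℝ (R : Set (EuclideanSpace ℝ (Fin r))) with hW
  have h3 : √3 ≠ 0 := by positivity
  have hperp {v : EuclideanSpace ℝ (Fin 48)} (hv : ∀ x ∈ R, inner ℝ x (restrictCoord g v) = 0) :
      v ∈ (W.map (extendCoord g))ᗮ := by
    rw [Submodule.mem_orthogonal]
    rintro _ ⟨a, ha, rfl⟩
    rw [inner_extendCoord_left]
    refine Submodule.span_induction (p := fun a _ => inner ℝ a (restrictCoord g v) = 0) hv
      (inner_zero_left _) (fun a b _ _ ha hb => ?_) (fun c a _ ha => ?_) ha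
    · rw [inner_add_left, ha, hb, add_zero]
    · rw [real_inner_smul_left, ha, mul_zero]
  constructor
  · refine le_antisymm (Submodule.span_le.mpr Set.inter_subset_right) ?_
    rw [Submodule.map_le_iff_le_comap, hW, Submodule.span_le]
    intro a ha
    rw [SetLike.mem_coe, Submodule.mem_comap]
    have hmem : √3 • extendCoord g a ∈ (ternaryCodeLattice C : Set (EuclideanSpace ℝ (Fin 48))) ∩
        (W.map (extendCoord g) : Set (EuclideanSpace ℝ (Fin 48))) :=
      ⟨sqrt_three_smul_extendCoord_mem hg (hR ha), Submodule.smul_mem _ √3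
        (Submodule.mem_map_of_mem (Submodule.subset_span ha))⟩
    have := Submodule.smul_mem _ (√3)⁻¹ (Submodule.subset_span (R := ℝ) hmem)
    rwa [inv_smul_smul₀ h3] at this
  · refine le_antisymm (Submodule.span_le.mpr Set.inter_subset_right) fun v hv => ?_
    obtain ⟨c, z, hz, hzR, hcz⟩ := horth (restrictCoord g v) fun x hx => by
      rw [← inner_extendCoord_left]
      exact hv _ (Submodule.mem_map_of_mem (Submodule.subset_span hx))
    have hzmem : √3 • extendCoord g ((2 : ℝ) • z) ∈ ternaryCodeLattice C := by
      refine sqrt_three_smul_extendCoord_mem hg ⟨fun i => ?_, ?_⟩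
      · obtain ⟨m, hm⟩ := hz i
        exact ⟨2 * m, by simp [hm]⟩
      · choose m hm using hz
        exact ⟨∑ i, m i, by simp [hm, Finset.mul_sum]⟩
    have hzperp : √3 • extendCoord g ((2 : ℝ) • z) ∈ (W.map (extendCoord g))ᗮ := by
      refine Submodule.smul_mem _ _ (hperp fun x hx => ?_)
      rw [restrictCoord_extendCoord hg, real_inner_smul_right, hzR x hx, mul_zero]
    have hsingle (j : Fin 48) (hj : j ∉ Set.range g) :
        EuclideanSpace.single j (1 : ℝ) ∈ Submodule.span ℝ
          ((ternaryCodeLattice C : Set (EuclideanSpace ℝ (Fin 48))) ∩ (W.map (extendCoord g))ᗮ) := by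
      have hmem : (2 * √3) • EuclideanSpace.single j (1 : ℝ) ∈ ternaryCodeLattice C := by
        refine mem_ternaryCodeLattice_of_six (z := Pi.single j 2) (fun i => ?_) ?_
        · rw [PiLp.smul_apply, smul_eq_mul, mul_comm 2, mul_assoc, sqrt_three_mul_eq]
          rcases eq_or_ne i j with rfl | h
          · simp
          · simp [h]
        · rw [Finset.sum_pi_single']
          simp
      have hjp : (2 * √3) • EuclideanSpace.single j (1 : ℝ) ∈ (W.map (extendCoord g))ᗮ := by
        refine Submodule.smul_mem _ _ (hperp fun x hx => ?_)
        have : restrictCoord g (EuclideanSpace.single j (1 : ℝ)) = 0 := by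
          ext i
          have hij : g i ≠ j := fun h => hj ⟨i, h⟩
          simp [restrictCoord_apply, hij]
        rw [this, inner_zero_right]
      have := Submodule.smul_mem _ (2 * √3)⁻¹ (Submodule.subset_span (R := ℝ)
        (Set.mem_inter (SetLike.mem_coe.mpr hmem) (SetLike.mem_coe.mpr hjp)))
      rwa [inv_smul_smul₀ (by positivity)] at this
    have hv' : v = (c / (2 * √3)) • (√3 • extendCoord g ((2 : ℝ) • z)) +
        ∑ j, (if j ∈ Set.range g then 0 else v j) • EuclideanSpace.single j (1 : ℝ) := by
      classical
      ext j
      have hs (d : Fin 48 → ℝ) : (∑ k, d k • EuclideanSpace.single k (1 : ℝ)) j = d j := by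
        simp [WithLp.ofLp_sum, Finset.sum_apply, Pi.single_apply]
      rw [PiLp.add_apply, hs fun k => if k ∈ Set.range g then 0 else v k]
      simp only [PiLp.smul_apply, smul_eq_mul]
      by_cases hj : j ∈ Set.range g
      · rw [if_pos hj, add_zero]
        obtain ⟨i, rfl⟩ := hj
        rw [extendCoord_apply_of_injective hg]
        have := congrArg (fun a : EuclideanSpace ℝ (Fin r) => a i) hcz
        simp only [restrictCoord_apply, PiLp.smul_apply, smul_eq_mul] at this ⊢
        rw [this]
        field_simp
      · rw [if_neg hj, extendCoord_apply_of_notMem _ hj]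
        ring
    rw [hv']
    refine add_mem (Submodule.smul_mem _ _ (Submodule.subset_span ⟨hzmem, hzperp⟩))
      (sum_mem fun j _ => ?_)
    split_ifs with hj
    · rw [zero_smul]
      exact zero_mem _
    · exact Submodule.smul_mem _ _ (hsingle j hj)

end Roots

/-! ### The antipode construction for the lattices of good codes -/

section RootSublattice

open Module Matrix

theorem mem_dualLattice {E : Type*} [NormedAddCommGroup E] [InnerProductSpace ℝ E]
    {K : Submodule ℤ E} {v : E} : v ∈ dualLattice K ↔
      (∀ x ∈ K, ∃ n : ℤ, inner ℝ v x = n) ∧ v ∈ Submodule.span ℝ (K : Set E) := by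
  refine and_congr (forall₂_congr fun x _ => ?_) Iff.rfl
  rw [Submodule.mem_one]
  exact exists_congr fun n => eq_comm

variable {C : Submodule (ZMod 3) (Fin 48 → ZMod 3)} {r : ℕ} {g : Fin r → Fin 48}
  {R : Submodule ℤ (EuclideanSpace ℝ (Fin r))}

theorem le_dualLattice (hR : R ≤ rootD r) : R ≤ dualLattice R := by
  refine fun a ha => mem_dualLattice.mpr ⟨fun x hx => ?_, Submodule.subset_span ha⟩
  choose p hp using (hR ha).1
  choose q hq using (hR hx).1
  exact ⟨∑ i, p i * q i, by simp [PiLp.inner_apply, hp, hq, mul_comm]⟩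

theorem inner_half_of_mem_rootD {x : Fin r → ℤ} {m : ℤ} (hx : ∀ i, x i ≡ m [ZMOD 2])
    {a : EuclideanSpace ℝ (Fin r)} (ha : a ∈ rootD r) :
    ∃ n : ℤ, inner ℝ (WithLp.toLp 2 fun i => (x i : ℝ) / 2) a = n := by
  obtain ⟨ha, q, hq⟩ := ha
  choose z hz using ha
  have hk (i : Fin r) : ∃ k, x i = m + 2 * k := by
    obtain ⟨k, hk⟩ := (hx i).symm.dvd
    exact ⟨k, by linarith⟩
  choose k hk using hk
  refine ⟨m * q + ∑ i, k i * z i, ?_⟩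
  have h (i : Fin r) : a i * ((x i : ℝ) / 2) = m / 2 * a i + k i * z i := by
    rw [hk, hz]
    push_cast
    ring
  simp only [PiLp.inner_apply, RCLike.inner_apply, conj_trivial, h, Finset.sum_add_distrib,
    ← Finset.mul_sum, hq]
  push_cast
  ring

theorem div_sqrt_twelve (x : ℝ) : x / √12 = 1 / √3 * (x / 2) := by
  rw [sqrt_twelve]
  field_simp

/-- Vectors of `Λ` restrict to `1 / √3` times `y / 2` with `y` of constant parity, and all such `y`
occur. These `y / 2` pair integrally with `R ⊆ D_r`, so they project into `R*`; by `hdual` their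
projections exhaust it. -/
theorem mem_smul_dualLattice_iff (hr : r < 48) (hg : Function.Injective g)
    (hC : ∀ x : Fin r → ZMod 3, ∃ c ∈ C, ∀ i, c (g i) = x i) (hR : R ≤ rootD r)
    (hdual : ∀ v ∈ dualLattice R, ∃ (y : Fin r → ℤ) (m : ℤ), (∀ i, y i ≡ m [ZMOD 2]) ∧
      ∀ x ∈ R, inner ℝ x (WithLp.toLp 2 (fun i => (y i : ℝ) / 2) - v) = 0)
    (v : EuclideanSpace ℝ (Fin r)) : v ∈ (1 / √3 : ℝ) • dualLattice R ↔
      ∃ w ∈ ternaryCodeLattice C, (Submodule.span ℝ (R : Set (EuclideanSpace ℝ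
        (Fin r)))).starProjection (restrictCoord g w) = v := by
  set W := Submodule.span ℝ (R : Set (EuclideanSpace ℝ (Fin r)))
  rw [Submodule.mem_smul_pointwise_iff_exists]
  have hw {w : EuclideanSpace ℝ (Fin 48)} {y : Fin r → ℤ} (h : ∀ i, w (g i) = (y i : ℝ) / √12) :
      restrictCoord g w = (1 / √3 : ℝ) • WithLp.toLp 2 (fun i => (y i : ℝ) / 2) := by
    ext i
    rw [restrictCoord_apply, h, div_sqrt_twelve]
    rfl
  constructor
  · rintro ⟨s, hs, rfl⟩
    obtain ⟨y, m, hy, hys⟩ := hdual s hs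
    obtain ⟨w, hwC, hwy⟩ := exists_mem_ternaryCodeLattice hr hC hg y m hy
    refine ⟨w, hwC, ?_⟩
    rw [hw hwy, map_smul]
    congr 1
    refine Submodule.eq_starProjection_of_mem_orthogonal (mem_dualLattice.mp hs).2 ?_
    rw [Submodule.mem_orthogonal]
    intro a ha
    refine Submodule.span_induction (p := fun a _ => inner ℝ a (_ - s) = 0) hys
      (inner_zero_left _) (fun a b _ _ ha hb => ?_) (fun c a _ ha => ?_) ha
    · rw [inner_add_left, ha, hb, add_zero]
    · rw [real_inner_smul_left, ha, mul_zero]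
  · rintro ⟨w, ⟨x, m, hx, hm, -, -⟩, rfl⟩
    rw [hw (y := fun i => x (g i)) fun i => hx (g i), map_smul]
    refine ⟨_, mem_dualLattice.mpr ⟨fun a ha => ?_, W.starProjection_apply_mem _⟩, rfl⟩
    rw [W.inner_starProjection_left_eq_right,
      Submodule.starProjection_eq_self_iff.mpr (Submodule.subset_span ha)]
    exact inner_half_of_mem_rootD (fun i => hm (g i)) (hR ha)

/-- The data concern the unscaled `R*`: passing to `R* / √3` divides the Gram determinant by `3 ^ k`
and squared distances by 3. -/
theorem IsGoodCode.antipodeConstructionGives (hC : IsGoodCode C) (hr : r ≤ 4)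
    (hR : R ≤ rootD r)
    (horth : ∀ a, (∀ x ∈ R, inner ℝ x a = 0) →
      ∃ (c : ℝ) (z : EuclideanSpace ℝ (Fin r)), (∀ i, ∃ m : ℤ, z i = m) ∧
        (∀ x ∈ R, inner ℝ x z = 0) ∧ a = c • z)
    (hdual : ∀ v ∈ dualLattice R, ∃ (y : Fin r → ℤ) (m : ℤ), (∀ i, y i ≡ m [ZMOD 2]) ∧
      ∀ x ∈ R, inner ℝ x (WithLp.toLp 2 (fun i => (y i : ℝ) / 2) - v) = 0)
    {k l s : ℕ} (hkl : k + l = 48) (hl : 0 < l) {d : Fin k → EuclideanSpace ℝ (Fin r)}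
    (hd : ∀ i, d i ∈ dualLattice R)
    (hspan : ∀ v ∈ dualLattice R, ∃ n : Fin k → ℤ, v = ∑ i, (n i : ℝ) • d i) {γ : ℝ} (hγ : 0 < γ)
    (hdet : (gram ℝ d).det = 3 ^ k * γ) {p : Fin s → EuclideanSpace ℝ (Fin r)}
    (hp : ∀ i, p i ∈ dualLattice R) (hinj : Function.Injective p) {β : ℝ} (hβ : β < 6)
    (hpd : ∀ i j, ‖p i - p j‖ ^ 2 ≤ 3 * β) {δ : ℝ}
    (hδ : δ = s * (1 / 2 * √(6 - β)) ^ l * √γ) :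
    AntipodeConstructionGives (ternaryCodeLattice C) 6 k l ((1 / √3 : ℝ) • dualLattice R) s β
      δ := by
  have h3 : (1 / √3 : ℝ) ^ 2 = 1 / 3 := by
    rw [div_pow, one_pow, Real.sq_sqrt (by norm_num)]
  have h30 : (1 / √3 : ℝ) ≠ 0 := by positivity
  obtain ⟨e, he, hCe⟩ := hC.exists_mem
  have hg : Function.Injective (e ∘ Fin.castLE hr) := he.comp (Fin.castLE_injective hr)
  have hCg (x : Fin r → ZMod 3) : ∃ c ∈ C, ∀ i, c ((e ∘ Fin.castLE hr) i) = x i := by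
    obtain ⟨c, hc, hcx⟩ := hCe (Function.extend (Fin.castLE hr) x 0)
    refine ⟨c, hc, fun i => ?_⟩
    rw [Function.comp_apply, hcx, (Fin.castLE_injective hr).extend_apply]
  set W := Submodule.span ℝ (R : Set (EuclideanSpace ℝ (Fin r)))
  have hdet0 : (gram ℝ d).det ≠ 0 := by
    rw [hdet]
    positivity
  have hli : LinearIndependent ℝ d := linearIndependent_of_det_gram_ne_zero hdet0
  have hWd : W = Submodule.span ℝ (Set.range d) := by
    refine le_antisymm (Submodule.span_le.mpr fun a ha => ?_) (Submodule.span_le.mpr ?_)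
    · obtain ⟨n, rfl⟩ := hspan a (le_dualLattice hR ha)
      exact sum_mem fun i _ => Submodule.smul_mem _ _ (Submodule.subset_span ⟨i, rfl⟩)
    · rintro _ ⟨i, rfl⟩
      exact (mem_dualLattice.mp (hd i)).2
  have hrank : finrank ℝ (W.map (extendCoord (e ∘ Fin.castLE hr))) = k := by
    rw [(Submodule.equivMapOfInjective _ (extendCoord_injective hg) W).symm.finrank_eq, hWd,
      finrank_span_eq_card hli, Fintype.card_fin]
  have hdN (i : Fin k) : (1 / √3 : ℝ) • d i ∈ (1 / √3 : ℝ) • dualLattice R :=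
    Submodule.smul_mem_pointwise_smul _ _ _ (hd i)
  have hgram : (gram ℝ fun i => (1 / √3 : ℝ) • d i).det = γ := by
    have : (gram ℝ fun i => (1 / √3 : ℝ) • d i) = (1 / 3 : ℝ) • gram ℝ d := by
      ext i j
      rw [Matrix.smul_apply, gram_apply, gram_apply, real_inner_smul_left, real_inner_smul_right,
        ← mul_assoc, ← sq, h3, smul_eq_mul]
    rw [this, det_smul, hdet, Fintype.card_fin, ← mul_assoc, ← mul_pow]
    norm_num
  let b : Basis (Fin k) ℤ ((1 / √3 : ℝ) • dualLattice R : Submodule ℤ _) := by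
    refine Basis.mk (v := fun i => ⟨(1 / √3 : ℝ) • d i, hdN i⟩) ?_ ?_
    · refine LinearIndependent.of_comp ((1 / √3 : ℝ) • dualLattice R : Submodule ℤ _).subtype ?_
      refine LinearIndependent.restrict_scalars' ℤ
        (v := fun i => (1 / √3 : ℝ) • d i) (linearIndependent_of_det_gram_ne_zero (𝕜 := ℝ) ?_)
      rw [hgram]
      exact hγ.ne'
    · rintro ⟨v, hv⟩ -
      obtain ⟨a, ha, rfl⟩ := (Submodule.mem_smul_pointwise_iff_exists _ _ _).mp hv
      obtain ⟨n, rfl⟩ := hspan a ha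
      rw [Submodule.mem_span_range_iff_exists_fun]
      refine ⟨n, Subtype.ext ?_⟩
      refine (AddSubmonoidClass.coe_finsetSum _ _).trans (Eq.trans ?_ Finset.smul_sum.symm)
      refine Finset.sum_congr rfl fun i _ => ?_
      rw [Submodule.coe_smul, smul_comm, Int.cast_smul_eq_zsmul]
  refine antipodeConstructionGives_of_basis hC.hasMinNorm hβ hC.covolume_sq b hγ ?_
    (p := fun i => (1 / √3 : ℝ) • p i)
    (fun i => Submodule.smul_mem_pointwise_smul _ _ _ (hp i)) (fun i j hij => ?_) (fun i j => ?_)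
    hl hδ ⟨W.map (extendCoord (e ∘ Fin.castLE hr)), hrank, ?_,
      splitsAlong_map_extendCoord hg hR horth,
      latticeIsometric_projLattice hg (mem_smul_dualLattice_iff (by omega) hg hCg hR hdual)⟩
  · simpa [b] using hgram
  · exact hinj (smul_right_injective _ h30 hij)
  · rw [← smul_sub, norm_smul, mul_pow, Real.norm_eq_abs, sq_abs, h3]
    linarith [hpd i j]
  · have := (W.map (extendCoord (e ∘ Fin.castLE hr))).finrank_add_finrank_orthogonal
    rw [finrank_euclideanSpace_fin, hrank] at this
    omega

end RootSublattice

/-! ### The root lattices `A_n` and `D_4` -/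

section RootA

open Matrix

variable {C : Submodule (ZMod 3) (Fin 48 → ZMod 3)} {n : ℕ}

theorem rootA_le_rootD : rootA n ≤ rootD (n + 1) := fun _ hx => ⟨hx.1, 0, by simp [hx.2]⟩

theorem single_sub_single_mem_rootA (i j : Fin (n + 1)) :
    EuclideanSpace.single i (1 : ℝ) - EuclideanSpace.single j (1 : ℝ) ∈ rootA n := by
  refine ⟨fun k => ⟨(if k = i then 1 else 0) - (if k = j then 1 else 0), ?_⟩, ?_⟩
  · simp
  · simp

theorem inner_single_sub_single (i j : Fin (n + 1)) (v : EuclideanSpace ℝ (Fin (n + 1))) :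
    inner ℝ (EuclideanSpace.single i (1 : ℝ) - EuclideanSpace.single j (1 : ℝ)) v = v i - v j := by
  rw [inner_sub_left, EuclideanSpace.inner_single_left, EuclideanSpace.inner_single_left]
  simp

theorem sum_eq_zero_of_mem_span_rootA {v : EuclideanSpace ℝ (Fin (n + 1))}
    (hv : v ∈ Submodule.span ℝ (rootA n : Set (EuclideanSpace ℝ (Fin (n + 1))))) :
    ∑ i, v i = 0 := by
  induction hv using Submodule.span_induction with
  | mem x hx => exact hx.2
  | zero => simp
  | add x y _ _ hx hy => simp [Finset.sum_add_distrib, hx, hy]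
  | smul c x _ hx => simp [← Finset.mul_sum, hx]

/-- Pairing with `e_i - e_0` shows that coordinates differ by integers. Conversely, the common real
shift `v 0` pairs to zero with vectors of coordinate sum zero. -/
theorem mem_dualLattice_rootA {v : EuclideanSpace ℝ (Fin (n + 1))} :
    v ∈ dualLattice (rootA n) ↔ (∀ i, ∃ m : ℤ, v i = v 0 + m) ∧ ∑ i, v i = 0 := by
  rw [mem_dualLattice]
  constructor
  · rintro ⟨h, hv⟩
    refine ⟨fun i => ?_, sum_eq_zero_of_mem_span_rootA hv⟩
    obtain ⟨m, hm⟩ := h _ (single_sub_single_mem_rootA i 0)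
    rw [real_inner_comm, inner_single_sub_single] at hm
    exact ⟨m, by linarith⟩
  · rintro ⟨h, hv⟩
    choose m hm using h
    constructor
    · rintro x ⟨hx, hx0⟩
      choose z hz using hx
      refine ⟨∑ i, m i * z i, ?_⟩
      have (i : Fin (n + 1)) : x i * v i = v 0 * x i + m i * z i := by
        rw [hm i, hz]
        ring
      simp only [PiLp.inner_apply, RCLike.inner_apply, conj_trivial, this,
        Finset.sum_add_distrib, ← Finset.mul_sum, hx0]
      push_cast
      ring
    · have : v = ∑ j, v j •
          (EuclideanSpace.single j (1 : ℝ) - EuclideanSpace.single 0 (1 : ℝ)) := by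
        ext i
        simp [WithLp.ofLp_sum, Finset.sum_apply, Pi.single_apply, mul_sub, Finset.sum_sub_distrib,
          hv]
      rw [this]
      exact sum_mem fun j _ => Submodule.smul_mem _ _
        (Submodule.subset_span (single_sub_single_mem_rootA j 0))

/-- The projections of the standard basis vectors other than the first one to the span of `A_n`. -/
noncomputable def dualA (n : ℕ) (i : Fin n) : EuclideanSpace ℝ (Fin (n + 1)) :=
  WithLp.toLp 2 fun j => (if i.succ = j then 1 else 0) - 1 / (n + 1)

theorem sum_dualA (i : Fin n) : ∑ j, dualA n i j = 0 := by
  have : (n + 1 : ℝ) ≠ 0 := by positivity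
  simp [dualA, Finset.sum_sub_distrib, this]

theorem dualA_mem (i : Fin n) : dualA n i ∈ dualLattice (rootA n) := by
  refine mem_dualLattice_rootA.mpr ⟨fun j => ⟨if i.succ = j then 1 else 0, ?_⟩, sum_dualA i⟩
  simp [dualA]
  ring

theorem eq_sum_smul_dualA {v : EuclideanSpace ℝ (Fin (n + 1))} (hv : ∑ i, v i = 0) :
    v = ∑ i : Fin n, (v i.succ - v 0) • dualA n i := by
  have hn : (n + 1 : ℝ) ≠ 0 := by positivity
  have h : ∑ i : Fin n, (v i.succ - v 0) = -(n + 1) * v 0 := by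
    rw [Fin.sum_univ_succ] at hv
    rw [Finset.sum_sub_distrib]
    simp
    linarith
  ext j
  have : (∑ i : Fin n, (v i.succ - v 0) • dualA n i) j =
      (∑ i : Fin n, (v i.succ - v 0) * (if i.succ = j then 1 else 0)) + v 0 := by
    rw [WithLp.ofLp_sum, Finset.sum_apply]
    refine (Finset.sum_congr rfl fun i _ => mul_sub _ _ _).trans ?_
    rw [Finset.sum_sub_distrib, ← Finset.sum_mul, h]
    field_simp
    ring
  rw [this]
  refine Fin.cases ?_ (fun j => ?_) j
  · simp [Fin.succ_ne_zero]
  · simp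

theorem gram_dualA : gram ℝ (dualA n) =
    1 - replicateCol Unit (fun _ => (1 / (n + 1) : ℝ)) * replicateRow Unit fun _ => (1 : ℝ) := by
  ext i j
  have (k : Fin (n + 1)) : dualA n j k * dualA n i k =
      (if i.succ = k then 1 else 0) * dualA n j k - 1 / (n + 1) * dualA n j k := by
    rw [mul_comm, ← sub_mul]
    rfl
  simp only [gram_apply, PiLp.inner_apply, RCLike.inner_apply, conj_trivial, this,
    Finset.sum_sub_distrib, ← Finset.mul_sum, sum_dualA, ite_mul, one_mul, zero_mul,
    Finset.sum_ite_eq, Finset.mem_univ, if_true]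
  simp [dualA, Matrix.mul_apply, Matrix.one_apply, eq_comm]

/-- The Gram matrix is the identity minus a rank-one matrix, so the determinant is `1 - n / (n +
1)`. -/
theorem det_gram_dualA : (gram ℝ (dualA n)).det = 1 / (n + 1) := by
  have : (n + 1 : ℝ) ≠ 0 := by positivity
  rw [gram_dualA, det_one_sub_mul_comm, det_unique]
  simp [Matrix.mul_apply]
  field_simp
  ring

/-- The integral vectors that become vectors of the dual of `A_n` when divided by `n + 1`. -/
def closeA (n : ℕ) (j i : Fin (n + 1)) : ℤ := (if 0 < i ∧ i ≤ j then n + 1 else 0) - (j : ℕ)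

/-- The points are the projections of `e_1 + … + e_j` for `0 ≤ j ≤ n`, one from each class of `A_n*
/ A_n`. With `d = |j - k|` their squared distances are `d (n + 1 - d) / (n + 1)`; `q` bounds these
after scaling by `(n + 1)²`. -/
theorem IsGoodCode.antipodeConstructionGives_rootA (hC : IsGoodCode C) (hn : n ≤ 3)
    (hsum : ∀ j, ∑ i, closeA n j i = 0)
    {q : ℤ} (hdist : ∀ j k, ∑ i, (closeA n j i - closeA n k i) ^ 2 ≤ q)
    {l s : ℕ} (hs : s = n + 1) (hnl : n + l = 48) (hl : 0 < l) {β γ δ : ℝ} (hγ : 0 < γ)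
    (hdet : 1 / (n + 1) = 3 ^ n * γ) (hβ : β < 6)
    (hq : (q : ℝ) = 3 * β * (n + 1) ^ 2)
    (hδ : δ = s * (1 / 2 * √(6 - β)) ^ l * √γ) :
    AntipodeConstructionGives (ternaryCodeLattice C) 6 n l ((1 / √3 : ℝ) • dualLattice (rootA n)) s
      β δ := by
  subst hs
  have hn0 : (n + 1 : ℝ) ≠ 0 := by positivity
  refine hC.antipodeConstructionGives (by omega) rootA_le_rootD (fun a ha => ?_) (fun v hv => ?_)
    hnl hl dualA_mem (fun v hv => ?_) hγ (det_gram_dualA.trans hdet)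
    (p := fun j => WithLp.toLp 2 fun i => (closeA n j i : ℝ) / (n + 1)) (fun j => ?_)
    (fun j k hjk => ?_) hβ (fun j k => ?_) hδ
  · refine ⟨a 0, WithLp.toLp 2 fun _ => 1, fun i => ⟨1, by simp⟩, fun x hx => ?_, ?_⟩
    · simpa [PiLp.inner_apply] using hx.2
    · ext i
      have := ha _ (single_sub_single_mem_rootA i 0)
      rw [inner_single_sub_single] at this
      simp
      linarith
  · choose m hm using (mem_dualLattice_rootA.mp hv).1
    -- Here `v` differs from the integral vector `m` by a multiple of the all-ones vector, which is
    -- orthogonal to `A_n`.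
    refine ⟨fun i => 2 * m i, 0, fun i => Int.modEq_zero_iff_dvd.mpr ⟨m i, rfl⟩, fun x hx => ?_⟩
    have (i : Fin (n + 1)) : (((2 * m i : ℤ) : ℝ) / 2 - v i) * x i = -v 0 * x i := by
      rw [hm i]
      push_cast
      ring
    simp only [PiLp.inner_apply, PiLp.sub_apply, RCLike.inner_apply, conj_trivial, this,
      ← Finset.mul_sum, hx.2, mul_zero]
  · obtain ⟨hm, h0⟩ := mem_dualLattice_rootA.mp hv
    choose m hm using hm
    refine ⟨fun i => m i.succ, (eq_sum_smul_dualA h0).trans (Finset.sum_congr rfl fun i _ => ?_)⟩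
    rw [hm i.succ, add_sub_cancel_left]
  · refine mem_dualLattice_rootA.mpr ⟨fun i => ⟨if 0 < i ∧ i ≤ j then 1 else 0, ?_⟩, ?_⟩
    · simp only [closeA, lt_self_iff_false, false_and, if_false]
      split_ifs <;> (push_cast; field_simp; ring)
    · rw [← Finset.sum_div, ← Int.cast_sum, hsum]
      simp
  · have := congrArg (fun a : EuclideanSpace ℝ (Fin (n + 1)) => a 0) hjk
    simp only [closeA, lt_self_iff_false, false_and, if_false] at this
    field_simp at this
    simpa [Fin.ext_iff] using this
  · have h : ∑ i, ((closeA n j i : ℝ) - closeA n k i) ^ 2 ≤ q := by exact_mod_cast hdist j k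
    rw [EuclideanSpace.real_norm_sq_eq]
    simp only [PiLp.sub_apply, ← sub_div, div_pow, ← Finset.sum_div]
    rwa [div_le_iff₀ (by positivity), ← hq]

end RootA

section RootD

open Matrix

variable {C : Submodule (ZMod 3) (Fin 48 → ZMod 3)} {n : ℕ}

theorem two_smul_single_mem_rootD (i : Fin n) : EuclideanSpace.single i (2 : ℝ) ∈ rootD n := by
  refine ⟨fun k => ⟨if k = i then 2 else 0, ?_⟩, 1, ?_⟩
  · simp
  · simp

/-- Pairing with `2 e_i` makes the coordinates half-integral, and pairing with `e_i - e_0` gives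
their doubles equal parity. -/
theorem mem_dualLattice_rootD {v : EuclideanSpace ℝ (Fin (n + 1))} :
    v ∈ dualLattice (rootD (n + 1)) ↔ ∃ (y : Fin (n + 1) → ℤ) (m : ℤ), (∀ i, y i ≡ m [ZMOD 2]) ∧
      v = WithLp.toLp 2 fun i => (y i : ℝ) / 2 := by
  rw [mem_dualLattice]
  constructor
  · rintro ⟨h, -⟩
    have h2 (i : Fin (n + 1)) : ∃ y : ℤ, 2 * v i = y := by
      obtain ⟨y, hy⟩ := h _ (two_smul_single_mem_rootD i)
      refine ⟨y, ?_⟩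
      rw [← hy, EuclideanSpace.inner_single_right]
      simp
    choose y hy using h2
    refine ⟨y, y 0, fun i => ?_, ?_⟩
    · obtain ⟨k, hk⟩ := h _ (rootA_le_rootD (single_sub_single_mem_rootA i 0))
      rw [real_inner_comm, inner_single_sub_single] at hk
      refine Int.modEq_iff_dvd.mpr ⟨-k, ?_⟩
      have : (y 0 - y i : ℝ) = 2 * -k := by
        rw [← hy, ← hy, ← hk]
        ring
      exact_mod_cast this
    · ext i
      simp [← hy]
  · rintro ⟨y, m, hy, rfl⟩
    refine ⟨fun x hx => inner_half_of_mem_rootD hy hx, ?_⟩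
    have : (WithLp.toLp 2 fun i => (y i : ℝ) / 2) =
        ∑ j, ((y j : ℝ) / 4) • EuclideanSpace.single j (2 : ℝ) := by
      ext i
      simp [WithLp.ofLp_sum, Finset.sum_apply, Pi.single_apply]
      ring
    rw [this]
    exact sum_mem fun j _ => Submodule.smul_mem _ _
      (Submodule.subset_span (two_smul_single_mem_rootD j))

/-- Twice the vectors of a basis of the dual of `D_4`. -/
def doubleDualD : Fin 4 → Fin 4 → ℤ :=
  ![![0, 2, 0, 0], ![0, 0, 2, 0], ![0, 0, 0, 2], ![1, 1, 1, 1]]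

/-- Twice the vectors of a regular simplex in the dual of `D_4`. -/
def doubleCloseD : Fin 4 → Fin 4 → ℤ :=
  ![![0, 0, 0, 0], ![0, 2, 0, 0], ![1, 1, 1, 1], ![1, 1, -1, 1]]

theorem det_gram_doubleDualD :
    (gram ℝ fun j => WithLp.toLp 2 fun i => (doubleDualD j i : ℝ) / 2).det = 1 / 4 := by
  have h : (gram ℝ fun j => WithLp.toLp 2 fun i => (doubleDualD j i : ℝ) / 2) =
      (1 / 4 : ℝ) • (Int.castRingHom ℝ).mapMatrix
        (of doubleDualD * (of doubleDualD)ᵀ) := by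
    ext i j
    rw [Matrix.smul_apply, RingHom.mapMatrix_apply, Matrix.map_apply, Matrix.mul_apply, map_sum,
      smul_eq_mul, Finset.mul_sum, gram_apply, PiLp.inner_apply]
    refine Finset.sum_congr rfl fun k _ => ?_
    simp
    ring
  have hdet : (of doubleDualD * (of doubleDualD)ᵀ).det = 64 := by decide +kernel
  rw [h, det_smul, ← RingHom.map_det, hdet]
  norm_num

theorem IsGoodCode.antipodeConstructionGives_rootD (hC : IsGoodCode C) {δ : ℝ}
    (hδ : δ = (4 : ℕ) * (1 / 2 * √(6 - 1 / 3)) ^ 44 * √(1 / 324)) :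
    AntipodeConstructionGives (ternaryCodeLattice C) 6 4 44 ((1 / √3 : ℝ) • dualLattice (rootD 4)) 4
      (1 / 3) δ := by
  refine hC.antipodeConstructionGives le_rfl le_rfl (fun a ha => ?_) (fun v hv => ?_)
    (by norm_num) (by norm_num) (d := fun j => WithLp.toLp 2 fun i => (doubleDualD j i : ℝ) / 2)
    (fun j => ?_) (fun v hv => ?_) (by norm_num)
    (det_gram_doubleDualD.trans (by norm_num))
    (p := fun j => WithLp.toLp 2 fun i => (doubleCloseD j i : ℝ) / 2) (fun j => ?_)
    (fun j k hjk => ?_) (by norm_num) (fun j k => ?_) hδ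
  · refine ⟨0, 0, fun i => ⟨0, by simp⟩, fun x _ => inner_zero_right x, ?_⟩
    ext i
    have := ha _ (two_smul_single_mem_rootD i)
    rw [EuclideanSpace.inner_single_left] at this
    simpa using this
  · obtain ⟨y, m, hy, rfl⟩ := mem_dualLattice_rootD.mp hv
    exact ⟨y, m, hy, fun x _ => by rw [sub_self, inner_zero_right]⟩
  · have h : ∀ j i, doubleDualD j i ≡ doubleDualD j 0 [ZMOD 2] := by decide
    exact mem_dualLattice_rootD.mpr ⟨_, _, h j, rfl⟩
  · obtain ⟨y, m, hy, rfl⟩ := mem_dualLattice_rootD.mp hv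
    have h (i : Fin 4) : ∃ k, y i = y 0 + 2 * k := by
      obtain ⟨k, hk⟩ := ((hy 0).trans (hy i).symm).dvd
      exact ⟨k, by linarith⟩
    choose k hk using h
    -- Only the last basis vector, with all coordinates `1/2`, is nonzero at coordinate 0, so its
    -- coefficient is `y 0`.
    refine ⟨![k 1, k 2, k 3, y 0], ?_⟩
    ext i
    have hki : (y i : ℝ) = y 0 + 2 * k i := by exact_mod_cast hk i
    fin_cases i <;> simp [Fin.sum_univ_four, doubleDualD] at hki ⊢ <;> linarith
  · have h : ∀ j i, doubleCloseD j i ≡ doubleCloseD j 0 [ZMOD 2] := by decide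
    exact mem_dualLattice_rootD.mpr ⟨_, _, h j, rfl⟩
  · have h : ∀ j k, (∀ i, doubleCloseD j i = doubleCloseD k i) → j = k := by decide
    refine h j k fun i => ?_
    have := congrArg (fun a : EuclideanSpace ℝ (Fin 4) => a i) hjk
    simp only at this
    field_simp at this
    exact_mod_cast this
  · have h : ∀ j k, ∑ i, (doubleCloseD j i - doubleCloseD k i) ^ 2 ≤ 4 := by decide
    have h' : ∑ i, ((doubleCloseD j i : ℝ) - doubleCloseD k i) ^ 2 ≤ 4 := by exact_mod_cast h j k
    rw [EuclideanSpace.real_norm_sq_eq]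
    simp only [PiLp.sub_apply, ← sub_div, div_pow, ← Finset.sum_div]
    linarith

end RootD

/-! ### Closed forms of the center densities -/

section Main

/-- Both sides are positive, and squaring makes all exponents integral. -/
theorem centerDensity_dim_fortySeven :
    (2 : ℝ) ^ (-70 : ℝ) * (3 : ℝ) ^ (-24 : ℝ) * (35 : ℝ) ^ (23.5 : ℝ) =
      (2 : ℕ) * (1 / 2 * √(6 - 1 / 6)) ^ 47 * √(1 / 6) := by
  have h : (1 / 2 * √(6 - 1 / 6 : ℝ)) = √(35 / 24) := by
    rw [← Real.sqrt_sq (show (0:ℝ) ≤ 1 / 2 by norm_num), ← Real.sqrt_mul (by norm_num)]; norm_num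
  rw [← sq_eq_sq₀ (by positivity) (by positivity), h]
  simp only [mul_pow]
  rw [← pow_mul, mul_comm 47 2, pow_mul, Real.sq_sqrt (by norm_num), Real.sq_sqrt (by norm_num)]
  simp only [← Real.rpow_natCast (_ ^ (_ : ℝ)) 2, ← Real.rpow_mul (show (0 : ℝ) ≤ 2 by norm_num),
    ← Real.rpow_mul (show (0 : ℝ) ≤ 3 by norm_num), ← Real.rpow_mul (show (0 : ℝ) ≤ 35 by norm_num)]
  norm_num

theorem centerDensity_dim_fortySix :
    (3 : ℝ) ^ (-46.5 : ℝ) * (13 : ℝ) ^ (23 : ℝ) =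
      (3 : ℕ) * (1 / 2 * √(6 - 2 / 9)) ^ 46 * √(1 / 27) := by
  have h : (1 / 2 * √(6 - 2 / 9 : ℝ)) = √(13 / 9) := by
    rw [← Real.sqrt_sq (show (0:ℝ) ≤ 1 / 2 by norm_num), ← Real.sqrt_mul (by norm_num)]; norm_num
  rw [← sq_eq_sq₀ (by positivity) (by positivity), h]
  simp only [mul_pow]
  rw [← pow_mul, mul_comm 46 2, pow_mul, Real.sq_sqrt (by norm_num), Real.sq_sqrt (by norm_num)]
  simp only [← Real.rpow_natCast (_ ^ (_ : ℝ)) 2, 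
    ← Real.rpow_mul (show (0 : ℝ) ≤ 3 by norm_num), ← Real.rpow_mul (show (0 : ℝ) ≤ 13 by norm_num)]
  norm_num

theorem centerDensity_dim_fortyFive :
    (2 : ℝ) ^ (-44 : ℝ) * (3 : ℝ) ^ (-24 : ℝ) * (17 : ℝ) ^ (22.5 : ℝ) =
      (4 : ℕ) * (1 / 2 * √(6 - 1 / 3)) ^ 45 * √(1 / 108) := by
  have h : (1 / 2 * √(6 - 1 / 3 : ℝ)) = √(17 / 12) := by
    rw [← Real.sqrt_sq (show (0:ℝ) ≤ 1 / 2 by norm_num), ← Real.sqrt_mul (by norm_num)]; norm_num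
  rw [← sq_eq_sq₀ (by positivity) (by positivity), h]
  simp only [mul_pow]
  rw [← pow_mul, mul_comm 45 2, pow_mul, Real.sq_sqrt (by norm_num), Real.sq_sqrt (by norm_num)]
  simp only [← Real.rpow_natCast (_ ^ (_ : ℝ)) 2, ← Real.rpow_mul (show (0 : ℝ) ≤ 2 by norm_num),
    ← Real.rpow_mul (show (0 : ℝ) ≤ 3 by norm_num), ← Real.rpow_mul (show (0 : ℝ) ≤ 17 by norm_num)]
  norm_num

theorem centerDensity_dim_fortyFour :
    (2 : ℝ) ^ (-43 : ℝ) * (3 : ℝ) ^ (-24 : ℝ) * (17 : ℝ) ^ (22 : ℝ) =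
      (4 : ℕ) * (1 / 2 * √(6 - 1 / 3)) ^ 44 * √(1 / 324) := by
  have h : (1 / 2 * √(6 - 1 / 3 : ℝ)) = √(17 / 12) := by
    rw [← Real.sqrt_sq (show (0:ℝ) ≤ 1 / 2 by norm_num), ← Real.sqrt_mul (by norm_num)]; norm_num
  rw [← sq_eq_sq₀ (by positivity) (by positivity), h]
  simp only [mul_pow]
  rw [← pow_mul, mul_comm 44 2, pow_mul, Real.sq_sqrt (by norm_num), Real.sq_sqrt (by norm_num)]
  simp only [← Real.rpow_natCast (_ ^ (_ : ℝ)) 2, ← Real.rpow_mul (show (0 : ℝ) ≤ 2 by norm_num),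
    ← Real.rpow_mul (show (0 : ℝ) ≤ 3 by norm_num), ← Real.rpow_mul (show (0 : ℝ) ≤ 17 by norm_num)]
  norm_num

theorem exists_isGoodCode_of_eq {Λ : Submodule ℤ (EuclideanSpace ℝ (Fin 48))}
    (hΛ : Λ = P48p ∨ Λ = P48q) : ∃ C, IsGoodCode C ∧ Λ = ternaryCodeLattice C := by
  rcases hΛ with rfl | rfl
  · exact ⟨_, isGoodCode_plessCode48, rfl⟩
  · exact ⟨_, isGoodCode_extendedQRCode48, rfl⟩

end Main

theorem mainTheorem3 (Λ : Submodule ℤ (EuclideanSpace ℝ (Fin 48))) (hΛ : Λ = P48p ∨ Λ = P48q) :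
    AntipodeConstructionGives Λ 6 1 47 ((1 / √3 : ℝ) • dualLattice (rootA 1)) 2 (1 / 6)
      ((2 : ℝ) ^ (-70 : ℝ) * (3 : ℝ) ^ (-24 : ℝ) * (35 : ℝ) ^ (23.5 : ℝ)) ∧
    AntipodeConstructionGives Λ 6 2 46 ((1 / √3 : ℝ) • dualLattice (rootA 2)) 3 (2 / 9)
      ((3 : ℝ) ^ (-46.5 : ℝ) * (13 : ℝ) ^ (23 : ℝ)) ∧
    AntipodeConstructionGives Λ 6 3 45 ((1 / √3 : ℝ) • dualLattice (rootA 3)) 4 (1 / 3)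
      ((2 : ℝ) ^ (-44 : ℝ) * (3 : ℝ) ^ (-24 : ℝ) * (17 : ℝ) ^ (22.5 : ℝ)) ∧
    AntipodeConstructionGives Λ 6 4 44 ((1 / √3 : ℝ) • dualLattice (rootD 4)) 4 (1 / 3)
      ((2 : ℝ) ^ (-43 : ℝ) * (3 : ℝ) ^ (-24 : ℝ) * (17 : ℝ) ^ (22 : ℝ)) := by
  obtain ⟨C, hC, rfl⟩ := exists_isGoodCode_of_eq hΛ
  -- `γ = 3^(-n) / (n + 1)` is the Gram determinant of `A_n* / √3`, and `q = 3β (n + 1)²`.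
  exact ⟨hC.antipodeConstructionGives_rootA (γ := 1 / 6) (q := 2) (by norm_num) (by decide)
      (by decide) rfl rfl (by norm_num) (by norm_num) (by norm_num) (by norm_num) (by norm_num)
      centerDensity_dim_fortySeven,
    hC.antipodeConstructionGives_rootA (γ := 1 / 27) (q := 6) (by norm_num) (by decide)
      (by decide) rfl rfl (by norm_num) (by norm_num) (by norm_num) (by norm_num) (by norm_num)
      centerDensity_dim_fortySix,
    hC.antipodeConstructionGives_rootA (γ := 1 / 108) (q := 16) (by norm_num) (by decide)
      (by decide) rfl rfl (by norm_num) (by norm_num) (by norm_num) (by norm_num) (by norm_num)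
      centerDensity_dim_fortyFive,
    hC.antipodeConstructionGives_rootD centerDensity_dim_fortyFour⟩
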